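/- Let $p$ be a prime and let $R$ be a $C_p$-Tambara functor, that is, commutative rings $R(C_p/e)$ (with an action of $C_p$ by ring automorphisms) and $R(C_p/C_p)$ with a restriction $\mathrm{Res}\colon R(C_p/C_p)\to R(C_p/e)$, a transfer $\mathrm{Tr}$ and a norm $\mathrm{Nm}\colon R(C_p/e)\to R(C_p/C_p)$ satisfying the usual axioms (in particular Frobenius reciprocity, Tambara reciprocity and $\mathrm{Nm}(0)=0$). The ghost of $R$ is the $C_p$-Tambara functor $\mathrm{ghost}(R)$ with $$\mathrm{ghost}(R)(C_p/e)=R(C_p/e),\qquad \mathrm{ghost}(R)(C_p/C_p)=R(C_p/e)^{C_p}\times R(C_p/C_p)/\mathrm{im}(\mathrm{Tr}),$$ restriction $(x,y)\mapsto x$, transfer $a\mapsto(\sum_{g} ga,\,0)$ and norm $a\mapsto(\prod_{g} ga,\,[\mathrm{Nm}(a)])$. For a commutative ring $A$, the coinduction $\mathrm{CoInd}_e^{C_p}A$ is the $C_p$-Tambara functor with level $C_p/e$ the ring of functions $C_p\to A$ (with the translation action), level $C_p/C_p$ the ring $A$, restriction the diagonal, transfer the sum of the values and norm the product of the values. The canonical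 map $$\mathrm{ghost}(R)\longrightarrow \mathrm{CoInd}_e^{C_p}R(C_p/e)$$ is $a\mapsto(g\mapsto ga)$ on level $C_p/e$ and the restriction $(x,y)\mapsto x$ on level $C_p/C_p$. A morphism $R\to S$ of $C_p$-Tambara functors is étale if (i) it is finitely presented, i.e. $S$ is isomorphic as an $R$-algebra to the quotient of a polynomial $R$-algebra on finitely many generators (each on level $C_p/e$ or $C_p/C_p$) by a finitely generated Tambara ideal; (ii) it is flat, i.e. $-\mathbin{\square}_R S$ is an exact functor on $R$-modules; and (iii) the genuine Kähler differentials $I/I^{>1}$ vanish, where $I$ is the kernel of the multiplication $S\mathbin{\square}_R S\to S$ and $I^{>1}$ is the Tambara ideal generated by all products of two elements of $I$ on the same level and all norms of elements of $I(C_p/e)$. The Nakaoka spectrum $\mathrm{Spec}(R)$ is the set of prime Tambara ideals of $R$ (proper ideals $\mathfrak p$ such that $I\cdot J\subseteq\mathfrak p$ implies $I\subseteq\mathfrak p$ or $J\subseteq\mathfrak p$), with the topology whose closed sets are generated by the sets $V(I)=\{\mathfrak p : I\subseteq\mathfrak p\}$ for all Tambara ideals $I$; a morphism induces a map of spectra by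 taking preimages. Suppose that the transfer $\mathrm{Tr}\colon R(C_p/e)\to R(C_p/C_p)$ is not surjective. Then the canonical map $\mathrm{ghost}(R)\to\mathrm{CoInd}_e^{C_p}R(C_p/e)$ is étale, but the induced map of Nakaoka spectra $\mathrm{Spec}(\mathrm{CoInd}_e^{C_p}R(C_p/e))\to\mathrm{Spec}(\mathrm{ghost}(R))$ is not open. -/

import Mathlib

open scoped Pointwise TensorProduct

universe u

/-- The cyclic group `C_p` of order `p`, written multiplicatively. -/
abbrev Cp (p : ℕ) : Type := Multiplicative (ZMod p)

/-! ### Orbits of mixed subsets of `C_p` -/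

/-- The subsets of `C_p` that are neither empty nor everything. -/
def MixedSubset (p : ℕ) [Fact p.Prime] : Type :=
  {U : Finset (Cp p) // U.Nonempty ∧ U ≠ Finset.univ}

namespace MixedSubset

variable {p : ℕ} [Fact p.Prime]

/-- `C_p` acts on its mixed subsets by translation. -/
instance : MulAction (Cp p) (MixedSubset p) where
  smul g U := ⟨g • U.1, U.2.1.smul_finset, fun h => U.2.2 (by
    have h' : g • U.1 = g • Finset.univ := by rw [h, Finset.smul_finset_univ]
    exact smul_left_cancel g h')⟩
  one_smul U := Subtype.ext (one_smul (Cp p) U.1)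
  mul_smul g h U := Subtype.ext (mul_smul g h U.1)

theorem coe_smul (g : Cp p) (U : MixedSubset p) : (g • U).1 = g • U.1 := rfl

instance : Finite (MixedSubset p) := Subtype.finite

theorem stabilizer_eq_bot (U : MixedSubset p) : MulAction.stabilizer (Cp p) U = ⊥ := by
  have : Fact (Nat.card (Cp p)).Prime := ⟨by
    rw [Nat.card_eq_fintype_card, Fintype.card_multiplicative, ZMod.card]; exact Fact.out⟩
  rcases Subgroup.eq_bot_or_eq_top_of_prime_card (MulAction.stabilizer (Cp p) U) with h | h
  · exact h
  · exfalso
    obtain ⟨x, hx⟩ := U.2.1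
    refine U.2.2 (Finset.eq_univ_iff_forall.2 fun y => ?_)
    have hm : y * x⁻¹ ∈ MulAction.stabilizer (Cp p) U := h ▸ Subgroup.mem_top _
    have h1 : (y * x⁻¹) • U.1 = U.1 :=
      congrArg (fun V : MixedSubset p => V.1) (MulAction.mem_stabilizer_iff.1 hm)
    have h2 : (y * x⁻¹) • x ∈ (y * x⁻¹) • U.1 := Finset.smul_mem_smul_finset hx
    rw [h1] at h2
    simpa using h2

end MixedSubset

/-- The orbits of the mixed subsets of `C_p` under translation. -/
abbrev MixedOrbit (p : ℕ) [Fact p.Prime] : Type :=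
  MulAction.orbitRel.Quotient (Cp p) (MixedSubset p)

noncomputable instance (p : ℕ) [Fact p.Prime] : Fintype (MixedOrbit p) := Fintype.ofFinite _

/-- A subset of `C_p` representing the orbit `ω`. -/
noncomputable def MixedOrbit.rep {p : ℕ} [Fact p.Prime] (ω : MixedOrbit p) : Finset (Cp p) :=
  (Quotient.out ω : MixedSubset p).1

theorem MixedOrbit.sum_all {p : ℕ} [Fact p.Prime] {A : Type*} [AddCommMonoid A]
    (F : Finset (Cp p) → A) :
    ∑ U : Finset (Cp p), F U =
      F Finset.univ + F ∅ + ∑ ω : MixedOrbit p, ∑ g : Cp p, F (g • ω.rep) := by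
  classical
  let _ : Fintype (MixedSubset p) := Fintype.ofFinite _
  have e1 : ∑ ω : MixedOrbit p, ∑ g : Cp p, F (g • ω.rep) = ∑ U : MixedSubset p, F U.1 := by
    rw [← Fintype.sum_prod_type']
    refine Fintype.sum_bijective
      (fun x : MixedOrbit p × Cp p => x.2 • (Quotient.out x.1 : MixedSubset p)) ⟨?_, ?_⟩ _ _ ?_
    · rintro ⟨ω, g⟩ ⟨ω', g'⟩ h
      simp only at h
      have hω : ω = ω' := by
        rw [← Quotient.out_eq ω, ← Quotient.out_eq ω']
        refine Quotient.sound ?_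
        change _ ∈ MulAction.orbit _ _
        refine ⟨g⁻¹ * g', ?_⟩
        simp only [mul_smul, ← h, inv_smul_smul]
      subst hω
      have : g⁻¹ * g' ∈ MulAction.stabilizer (Cp p) (Quotient.out ω : MixedSubset p) := by
        rw [MulAction.mem_stabilizer_iff, mul_smul, ← h, inv_smul_smul]
      rw [MixedSubset.stabilizer_eq_bot, Subgroup.mem_bot, inv_mul_eq_one] at this
      rw [this]
    · intro U
      have : (Quotient.mk (MulAction.orbitRel (Cp p) (MixedSubset p)) U).out ∈
          MulAction.orbit (Cp p) U :=
        Quotient.exact (Quotient.out_eq (Quotient.mk (MulAction.orbitRel (Cp p) _) U))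
      obtain ⟨g, hg⟩ := this
      refine ⟨(Quotient.mk _ U, g⁻¹), ?_⟩
      simp only
      rw [← hg]
      exact inv_smul_smul g U
    · rintro ⟨ω, g⟩
      rfl
  have e2 : ∑ U : MixedSubset p, F U.1 =
      ∑ U ∈ Finset.univ.filter (fun U : Finset (Cp p) => U.Nonempty ∧ U ≠ Finset.univ), F U :=
    (Finset.sum_subtype _ (by simp) F).symm
  have e3 : (Finset.univ.filter
      (fun U : Finset (Cp p) => ¬ (U.Nonempty ∧ U ≠ Finset.univ))) = {Finset.univ, ∅} := by
    ext U
    simp only [Finset.mem_filter, Finset.mem_univ, true_and, Finset.mem_insert,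
      Finset.mem_singleton, ← Finset.not_nonempty_iff_eq_empty]
    tauto
  rw [e1, e2, ← Finset.sum_filter_not_add_sum_filter Finset.univ
    (fun U : Finset (Cp p) => U.Nonempty ∧ U ≠ Finset.univ) F, e3,
    Finset.sum_pair Finset.univ_nonempty.ne_empty]

/-! ### `C_p`-Tambara functors -/

/-- A `C_p`-Tambara functor `R` (with values on the transitive `C_p`-sets), given by its Lewis
diagram: the commutative rings `bot = R(C_p/e)`, on which the Weyl group `C_p` acts by ring
automorphisms, and `top = R(C_p/C_p)`, with the restriction, the transfer and the norm between
them. The last field is the Tambara reciprocity for the norm of a sum; by `tr_smul` its summands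
do not depend on the chosen representatives of the orbits. -/
structure CpTambara (p : ℕ) [Fact p.Prime] : Type (u + 1) where
  bot : Type u
  top : Type u
  [ringBot : CommRing bot]
  [ringTop : CommRing top]
  [weyl : MulSemiringAction (Cp p) bot]
  res : top →+* bot
  tr : bot →+ top
  nm : bot →* top
  smul_res : ∀ (g : Cp p) (x : top), g • res x = res x
  tr_smul : ∀ (g : Cp p) (a : bot), tr (g • a) = tr a
  nm_smul : ∀ (g : Cp p) (a : bot), nm (g • a) = nm a
  nm_zero : nm 0 = 0
  res_tr : ∀ a : bot, res (tr a) = ∑ g : Cp p, g • a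
  res_nm : ∀ a : bot, res (nm a) = ∏ g : Cp p, g • a
  tr_mul_res : ∀ (a : bot) (x : top), tr (a * res x) = tr a * x
  nm_add : ∀ a b : bot, nm (a + b) = nm a + nm b +
    ∑ ω : MixedOrbit p, tr ((∏ g ∈ ω.rep, g • a) * ∏ g ∈ (ω.rep)ᶜ, g • b)

attribute [instance] CpTambara.ringBot CpTambara.ringTop CpTambara.weyl

namespace CpTambara

variable {p : ℕ} [Fact p.Prime]

/-- The expansion of a product of sums indexed by `C_p`. -/
theorem prod_add_eq {A : Type*} [CommRing A] (a b : Cp p → A) :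
    ∏ g, (a g + b g) = ∏ g, a g + ∏ g, b g +
      ∑ ω : MixedOrbit p, ∑ h : Cp p,
        (∏ g ∈ ω.rep, a (h * g)) * ∏ g ∈ (ω.rep)ᶜ, b (h * g) := by
  classical
  rw [Finset.prod_add, Finset.powerset_univ,
    MixedOrbit.sum_all (fun U => (∏ i ∈ U, a i) * ∏ i ∈ Finset.univ \ U, b i)]
  congr 1
  · simp
  · refine Finset.sum_congr rfl fun ω _ => Finset.sum_congr rfl fun h _ => ?_
    congr 1
    · rw [Finset.smul_finset_def, Finset.prod_image (fun _ _ _ _ h' => smul_left_cancel h h')]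
      rfl
    · have hc : Finset.univ \ h • ω.rep = h • (ω.rep)ᶜ := by
        rw [Finset.compl_eq_univ_sdiff, Finset.smul_finset_sdiff, Finset.smul_finset_univ]
      rw [hc, Finset.smul_finset_def,
        Finset.prod_image (fun _ _ _ _ h' => smul_left_cancel h h')]
      rfl

/-- A morphism of `C_p`-Tambara functors. -/
@[ext]
structure Hom (R S : CpTambara.{u} p) : Type u where
  bot : R.bot →+* S.bot
  top : R.top →+* S.top
  map_smul : ∀ (g : Cp p) (a : R.bot), bot (g • a) = g • bot a
  map_res : ∀ x : R.top, bot (R.res x) = S.res (top x)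
  map_tr : ∀ a : R.bot, top (R.tr a) = S.tr (bot a)
  map_nm : ∀ a : R.bot, top (R.nm a) = S.nm (bot a)

/-- The composite of two morphisms. -/
def Hom.comp {R S T : CpTambara.{u} p} (g : Hom S T) (f : Hom R S) : Hom R T where
  bot := g.bot.comp f.bot
  top := g.top.comp f.top
  map_smul h a := by simp [f.map_smul, g.map_smul]
  map_res x := by simp [f.map_res, g.map_res]
  map_tr a := by simp [f.map_tr, g.map_tr]
  map_nm a := by simp [f.map_nm, g.map_nm]

/-- The identity morphism. -/
def Hom.id (R : CpTambara.{u} p) : Hom R R where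
  bot := RingHom.id _
  top := RingHom.id _
  map_smul _ _ := rfl
  map_res _ := rfl
  map_tr _ := rfl
  map_nm _ := rfl

/-! ### Ideals and the Nakaoka spectrum -/

/-- A Tambara ideal of `R`. -/
@[ext]
structure TIdeal (R : CpTambara.{u} p) : Type u where
  bot : Ideal R.bot
  top : Ideal R.top
  smul_mem : ∀ (g : Cp p) {a : R.bot}, a ∈ bot → g • a ∈ bot
  res_mem : ∀ {x : R.top}, x ∈ top → R.res x ∈ bot
  tr_mem : ∀ {a : R.bot}, a ∈ bot → R.tr a ∈ top
  nm_mem : ∀ {a : R.bot}, a ∈ bot → R.nm a ∈ top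

namespace TIdeal

variable {R S : CpTambara.{u} p}

instance : LE (TIdeal R) := ⟨fun I J => I.bot ≤ J.bot ∧ I.top ≤ J.top⟩

instance : Top (TIdeal R) := ⟨{
  bot := ⊤
  top := ⊤
  smul_mem := fun _ _ _ => trivial
  res_mem := fun _ => trivial
  tr_mem := fun _ => trivial
  nm_mem := fun _ => trivial }⟩

instance : Bot (TIdeal R) := ⟨{
  bot := ⊥
  top := ⊥
  smul_mem := fun g a h => by rw [Ideal.mem_bot] at h ⊢; rw [h, smul_zero]
  res_mem := fun h => by rw [Ideal.mem_bot] at h ⊢; rw [h, map_zero]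
  tr_mem := fun h => by rw [Ideal.mem_bot] at h ⊢; rw [h, map_zero]
  nm_mem := fun h => by rw [Ideal.mem_bot] at h ⊢; rw [h, R.nm_zero] }⟩

/-- The Tambara ideal generated by a set of elements at each level: the intersection of all
Tambara ideals that contain them. -/
def span (s : Set R.bot) (t : Set R.top) : TIdeal R where
  bot := ⨅ (I : TIdeal R) (_ : s ⊆ I.bot ∧ t ⊆ I.top), I.bot
  top := ⨅ (I : TIdeal R) (_ : s ⊆ I.bot ∧ t ⊆ I.top), I.top
  smul_mem g a h := by
    simp only [Submodule.mem_iInf] at h ⊢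
    exact fun I hI => I.smul_mem g (h I hI)
  res_mem h := by
    simp only [Submodule.mem_iInf] at h ⊢
    exact fun I hI => I.res_mem (h I hI)
  tr_mem h := by
    simp only [Submodule.mem_iInf] at h ⊢
    exact fun I hI => I.tr_mem (h I hI)
  nm_mem h := by
    simp only [Submodule.mem_iInf] at h ⊢
    exact fun I hI => I.nm_mem (h I hI)

theorem span_le {s : Set R.bot} {t : Set R.top} {I : TIdeal R} :
    span s t ≤ I ↔ s ⊆ I.bot ∧ t ⊆ I.top := by
  constructor
  · intro h
    refine ⟨fun x hx => h.1 ?_, fun x hx => h.2 ?_⟩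
    · simp only [span, Submodule.mem_iInf]
      exact fun J hJ => hJ.1 hx
    · simp only [span, Submodule.mem_iInf]
      exact fun J hJ => hJ.2 hx
  · intro h
    exact ⟨iInf₂_le I h, iInf₂_le I h⟩

/-- `I` is generated by finitely many elements. -/
def FG (I : TIdeal R) : Prop :=
  ∃ (s : Finset R.bot) (t : Finset R.top), I = span (s : Set R.bot) (t : Set R.top)

/-- The product of two Tambara ideals. -/
instance : Mul (TIdeal R) :=
  ⟨fun I J => span (Set.image2 (fun a b => a * b) (I.bot : Set R.bot) (J.bot : Set R.bot))
    (Set.image2 (fun x y => x * y) (I.top : Set R.top) (J.top : Set R.top))⟩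

theorem mul_le {I J K : TIdeal R} : I * J ≤ K ↔
    (∀ a ∈ I.bot, ∀ b ∈ J.bot, a * b ∈ K.bot) ∧ (∀ x ∈ I.top, ∀ y ∈ J.top, x * y ∈ K.top) := by
  change span _ _ ≤ K ↔ _
  rw [span_le, Set.image2_subset_iff, Set.image2_subset_iff]
  rfl

/-- A prime Tambara ideal. -/
structure IsPrime (P : TIdeal R) : Prop where
  ne_top : P ≠ ⊤
  le_or_le : ∀ I J : TIdeal R, I * J ≤ P → I ≤ P ∨ J ≤ P

/-- The preimage of a Tambara ideal under a morphism. -/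
def comap (f : Hom R S) (I : TIdeal S) : TIdeal R where
  bot := I.bot.comap f.bot
  top := I.top.comap f.top
  smul_mem g a h := by
    rw [Ideal.mem_comap, f.map_smul]; exact I.smul_mem g h
  res_mem h := by
    rw [Ideal.mem_comap, f.map_res]; exact I.res_mem h
  tr_mem h := by
    rw [Ideal.mem_comap, f.map_tr]; exact I.tr_mem h
  nm_mem h := by
    rw [Ideal.mem_comap, f.map_nm]; exact I.nm_mem h

/-- The image under the transfer of an ideal of the bottom ring, as an ideal of the top ring. -/
def trIdeal (I : Ideal R.bot) : Ideal R.top where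
  carrier := {x | ∃ a ∈ I, R.tr a = x}
  add_mem' := by
    rintro _ _ ⟨a, ha, rfl⟩ ⟨b, hb, rfl⟩
    exact ⟨a + b, I.add_mem ha hb, map_add _ _ _⟩
  zero_mem' := ⟨0, I.zero_mem, map_zero _⟩
  smul_mem' := by
    rintro c _ ⟨a, ha, rfl⟩
    exact ⟨a * R.res c, I.mul_mem_right _ ha, by rw [R.tr_mul_res, smul_eq_mul, mul_comm]⟩

/-- The Tambara ideal of `S` generated by the image of a Tambara ideal of `R`. -/
def map (f : Hom R S) (I : TIdeal R) : TIdeal S where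
  bot := I.bot.map f.bot
  top := I.top.map f.top ⊔ trIdeal (I.bot.map f.bot)
  smul_mem g a h := by
    refine Submodule.span_induction (p := fun a _ => g • a ∈ I.bot.map f.bot) ?_ ?_ ?_ ?_ h
    · rintro _ ⟨b, hb, rfl⟩
      rw [← f.map_smul]
      exact Ideal.mem_map_of_mem _ (I.smul_mem g hb)
    · simp
    · intro a b _ _ ha hb
      rw [smul_add]
      exact Ideal.add_mem _ ha hb
    · intro c a _ ha
      rw [smul_eq_mul, smul_mul']
      exact Ideal.mul_mem_left _ _ ha
  res_mem h := by
    refine (sup_le (c := (I.bot.map f.bot).comap S.res) ?_ ?_) h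
    · rw [Ideal.map_le_iff_le_comap]
      intro y hy
      rw [Ideal.mem_comap, Ideal.mem_comap, ← f.map_res]
      exact Ideal.mem_map_of_mem _ (I.res_mem hy)
    · rintro _ ⟨a, ha, rfl⟩
      rw [Ideal.mem_comap, S.res_tr]
      refine Ideal.sum_mem _ fun g _ => ?_
      refine Submodule.span_induction (p := fun a _ => g • a ∈ I.bot.map f.bot) ?_ ?_ ?_ ?_ ha
      · rintro _ ⟨b, hb, rfl⟩
        rw [← f.map_smul]
        exact Ideal.mem_map_of_mem _ (I.smul_mem g hb)
      · simp
      · intro a b _ _ ha hb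
        rw [smul_add]
        exact Ideal.add_mem _ ha hb
      · intro c a _ ha
        rw [smul_eq_mul, smul_mul']
        exact Ideal.mul_mem_left _ _ ha
  tr_mem h := Ideal.mem_sup_right ⟨_, h, rfl⟩
  nm_mem h := by
    have key : ∀ g : Cp p, ∀ a ∈ I.bot.map f.bot, g • a ∈ I.bot.map f.bot := by
      intro g a ha
      refine Submodule.span_induction (p := fun a _ => g • a ∈ I.bot.map f.bot) ?_ ?_ ?_ ?_ ha
      · rintro _ ⟨b, hb, rfl⟩
        rw [← f.map_smul]
        exact Ideal.mem_map_of_mem _ (I.smul_mem g hb)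
      · simp
      · intro a b _ _ ha hb
        rw [smul_add]
        exact Ideal.add_mem _ ha hb
      · intro c a _ ha
        rw [smul_eq_mul, smul_mul']
        exact Ideal.mul_mem_left _ _ ha
    refine Submodule.span_induction
      (p := fun a _ => S.nm a ∈ I.top.map f.top ⊔ trIdeal (I.bot.map f.bot)) ?_ ?_ ?_ ?_ h
    · rintro _ ⟨b, hb, rfl⟩
      rw [← f.map_nm]
      exact Ideal.mem_sup_left (Ideal.mem_map_of_mem _ (I.nm_mem hb))
    · rw [S.nm_zero]
      exact Ideal.zero_mem _
    · intro a b ha' _ ha hb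
      rw [S.nm_add]
      refine Ideal.add_mem _ (Ideal.add_mem _ ha hb) (Ideal.sum_mem _ fun ω _ => ?_)
      refine Ideal.mem_sup_right ⟨_, ?_, rfl⟩
      refine Ideal.mul_mem_right _ _ ?_
      obtain ⟨g, hg⟩ := (Quotient.out ω : MixedSubset p).2.1
      exact Ideal.prod_mem _ hg (key g a ha')
    · intro c a _ ha
      rw [smul_eq_mul, map_mul]
      exact Ideal.mul_mem_left _ _ ha

theorem map_le_iff {f : Hom R S} {I : TIdeal R} {J : TIdeal S} :
    map f I ≤ J ↔ I ≤ comap f J := by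
  constructor
  · rintro ⟨h1, h2⟩
    exact ⟨Ideal.map_le_iff_le_comap.1 h1, Ideal.map_le_iff_le_comap.1 (le_sup_left.trans h2)⟩
  · rintro ⟨h1, h2⟩
    have h3 := Ideal.map_le_iff_le_comap.2 h1
    refine ⟨h3, sup_le (Ideal.map_le_iff_le_comap.2 h2) ?_⟩
    rintro _ ⟨a, ha, rfl⟩
    exact J.tr_mem (h3 ha)

theorem map_mul_map_le {f : Hom R S} {I J : TIdeal R} {K : TIdeal S}
    (h : I * J ≤ comap f K) : map f I * map f J ≤ K := by
  obtain ⟨h1, h2⟩ := mul_le.1 h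
  have hb : I.bot.map f.bot * J.bot.map f.bot ≤ K.bot := by
    rw [← Ideal.map_mul, Ideal.map_le_iff_le_comap, Ideal.mul_le]
    exact h1
  have ht : I.top.map f.top * J.top.map f.top ≤ K.top := by
    rw [← Ideal.map_mul, Ideal.map_le_iff_le_comap, Ideal.mul_le]
    exact h2
  refine mul_le.2 ⟨fun a ha b hb' => hb (Ideal.mul_mem_mul ha hb'), ?_⟩
  have aux1 : ∀ a ∈ (map f I).bot, ∀ y ∈ (map f J).top, S.tr a * y ∈ K.top := by
    intro a ha y hy
    rw [← S.tr_mul_res]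
    exact K.tr_mem (hb (Ideal.mul_mem_mul ha ((map f J).res_mem hy)))
  have aux2 : ∀ x ∈ (map f I).top, ∀ b ∈ (map f J).bot, x * S.tr b ∈ K.top := by
    intro x hx b hb'
    rw [mul_comm, ← S.tr_mul_res, mul_comm]
    exact K.tr_mem (hb (Ideal.mul_mem_mul ((map f I).res_mem hx) hb'))
  intro x hx y hy
  obtain ⟨x1, hx1, x2, ⟨a, ha, rfl⟩, rfl⟩ := Submodule.mem_sup.1 hx
  obtain ⟨y1, hy1, y2, ⟨b, hb', rfl⟩, rfl⟩ := Submodule.mem_sup.1 hy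
  rw [add_mul, mul_add]
  exact K.top.add_mem (K.top.add_mem (ht (Ideal.mul_mem_mul hx1 hy1))
    (aux2 x1 (Ideal.mem_sup_left hx1) b hb')) (aux1 a ha _ hy)

theorem IsPrime.comap {f : Hom R S} {P : TIdeal S} (hP : P.IsPrime) : (comap f P).IsPrime where
  ne_top h := hP.ne_top <| by
    have hb : (1 : R.bot) ∈ (TIdeal.comap f P).bot := h ▸ (trivial : (1 : R.bot) ∈ (⊤ : Ideal _))
    have ht : (1 : R.top) ∈ (TIdeal.comap f P).top := h ▸ (trivial : (1 : R.top) ∈ (⊤ : Ideal _))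
    have hb' : f.bot 1 ∈ P.bot := hb
    have ht' : f.top 1 ∈ P.top := ht
    rw [map_one] at hb' ht'
    exact TIdeal.ext ((Ideal.eq_top_iff_one _).2 hb') ((Ideal.eq_top_iff_one _).2 ht')
  le_or_le I J h := by
    rcases hP.le_or_le _ _ (map_mul_map_le h) with h | h
    · exact Or.inl (map_le_iff.1 h)
    · exact Or.inr (map_le_iff.1 h)

end TIdeal

/-- The kernel of a morphism. -/
def Hom.ker {R S : CpTambara.{u} p} (f : Hom R S) : TIdeal R := TIdeal.comap f ⊥

/-- The points of the Nakaoka spectrum of `R`. -/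
def Spec (R : CpTambara.{u} p) : Type u := {P : TIdeal R // P.IsPrime}

/-- The set of the prime ideals that contain `I`. -/
def Spec.zeroLocus {R : CpTambara.{u} p} (I : TIdeal R) : Set (Spec R) := {P | I ≤ P.1}

/-- The topology whose closed subsets are generated by the sets `zeroLocus I`. -/
instance (R : CpTambara.{u} p) : TopologicalSpace (Spec R) :=
  TopologicalSpace.generateFrom {U | ∃ I : TIdeal R, U = (Spec.zeroLocus I)ᶜ}

/-- The map of Nakaoka spectra induced by a morphism. -/
def Spec.map {R S : CpTambara.{u} p} (f : Hom R S) (P : Spec S) : Spec R :=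
  ⟨TIdeal.comap f P.1, P.2.comap⟩

/-! ### The ghost and coinduction from the trivial group -/

/-- The ideal of `R(C_p/C_p)` of all transfers. -/
def transferIdeal (R : CpTambara.{u} p) : Ideal R.top := TIdeal.trIdeal (⊤ : Ideal R.bot)

theorem tr_mem_transferIdeal (R : CpTambara.{u} p) (a : R.bot) : R.tr a ∈ R.transferIdeal :=
  ⟨a, trivial, rfl⟩

/-- The subring `R(C_p/e)^{C_p}` of fixed points. -/
def fixedPoints (R : CpTambara.{u} p) : Subring R.bot where
  carrier := {a | ∀ g : Cp p, g • a = a}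
  mul_mem' ha hb g := by rw [smul_mul', ha, hb]
  one_mem' g := smul_one g
  add_mem' ha hb g := by rw [smul_add, ha, hb]
  zero_mem' g := smul_zero g
  neg_mem' ha g := by rw [smul_neg, ha]

theorem sum_smul_mem (R : CpTambara.{u} p) (a : R.bot) :
    ∑ g : Cp p, g • a ∈ R.fixedPoints := fun h => by
  rw [← R.res_tr, R.smul_res]

theorem prod_smul_mem (R : CpTambara.{u} p) (a : R.bot) :
    ∏ g : Cp p, g • a ∈ R.fixedPoints := fun h => by
  rw [← R.res_nm, R.smul_res]

/-- The ghost of `R`: its levels are `R(C_p/e)` and `R(C_p/e)^{C_p} × R(C_p/C_p)/Tr`; the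
restriction is the first projection, the transfer is `a ↦ (∑ g • a, 0)` and the norm is
`a ↦ (∏ g • a, Nm a)`. -/
def ghost (R : CpTambara.{u} p) : CpTambara.{u} p where
  bot := R.bot
  top := R.fixedPoints × (R.top ⧸ R.transferIdeal)
  res := R.fixedPoints.subtype.comp (RingHom.fst _ _)
  tr := {
    toFun := fun a => (⟨∑ g : Cp p, g • a, R.sum_smul_mem a⟩, 0)
    map_zero' := by
      refine Prod.ext (Subtype.ext ?_) rfl
      simp
    map_add' := fun a b => by
      refine Prod.ext (Subtype.ext ?_) (add_zero _).symm
      simp [Finset.sum_add_distrib] }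
  nm := {
    toFun := fun a => (⟨∏ g : Cp p, g • a, R.prod_smul_mem a⟩,
      Ideal.Quotient.mk R.transferIdeal (R.nm a))
    map_one' := by
      refine Prod.ext (Subtype.ext ?_) ?_
      · simp
      · simp
    map_mul' := fun a b => by
      refine Prod.ext (Subtype.ext ?_) ?_
      · simp [Finset.prod_mul_distrib, smul_mul']
      · simp }
  smul_res g x := x.1.2 g
  tr_smul g a := by
    refine Prod.ext (Subtype.ext ?_) rfl
    change ∑ h : Cp p, h • g • a = ∑ h : Cp p, h • a
    rw [← R.res_tr, ← R.res_tr, R.tr_smul]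
  nm_smul g a := by
    refine Prod.ext (Subtype.ext ?_) ?_
    · change ∏ h : Cp p, h • g • a = ∏ h : Cp p, h • a
      rw [← R.res_nm, ← R.res_nm, R.nm_smul]
    · change Ideal.Quotient.mk _ (R.nm (g • a)) = Ideal.Quotient.mk _ (R.nm a)
      rw [R.nm_smul]
  nm_zero := by
    refine Prod.ext (Subtype.ext ?_) ?_
    · change ∏ h : Cp p, h • (0 : R.bot) = 0
      rw [← R.res_nm, R.nm_zero, map_zero]
    · change Ideal.Quotient.mk _ (R.nm 0) = 0
      rw [R.nm_zero, map_zero]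
  res_tr a := rfl
  res_nm a := rfl
  tr_mul_res a x := by
    refine Prod.ext (Subtype.ext ?_) (zero_mul _).symm
    change ∑ g : Cp p, g • (a * (x.1 : R.bot)) = (∑ g : Cp p, g • a) * (x.1 : R.bot)
    rw [Finset.sum_mul]
    refine Finset.sum_congr rfl fun g _ => ?_
    rw [smul_mul', x.1.2 g]
  nm_add a b := by
    refine Prod.ext (Subtype.ext ?_) ?_
    · simp only [Prod.fst_add, Prod.fst_sum, Subring.coe_add, AddSubmonoidClass.coe_finsetSum]
      change ∏ g : Cp p, g • (a + b) = ∏ g : Cp p, g • a + ∏ g : Cp p, g • b +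
        ∑ ω : MixedOrbit p, ∑ h : Cp p,
          h • ((∏ g ∈ ω.rep, g • a) * ∏ g ∈ (ω.rep)ᶜ, g • b)
      simp only [smul_add]
      rw [prod_add_eq]
      congr 1
      refine Finset.sum_congr rfl fun ω _ => Finset.sum_congr rfl fun h _ => ?_
      simp only [smul_mul', Finset.smul_prod', mul_smul]
    · simp only [Prod.snd_add, Prod.snd_sum]
      change Ideal.Quotient.mk _ (R.nm (a + b)) = Ideal.Quotient.mk _ (R.nm a) +
        Ideal.Quotient.mk _ (R.nm b) + ∑ ω : MixedOrbit p, 0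
      rw [R.nm_add, map_add, map_add, map_sum]
      congr 1
      exact Finset.sum_congr rfl fun ω _ =>
        Ideal.Quotient.eq_zero_iff_mem.2 (R.tr_mem_transferIdeal _)

/-- The coinduction `CoInd_e^{C_p} A` of a commutative ring `A` (a Tambara functor for the trivial
group): its levels are the functions on `C_p` with values in `A`, permuted by translation, and `A`;
the restriction is the diagonal, the transfer is the sum and the norm is the product of the
values. -/
def coind (p : ℕ) [Fact p.Prime] (A : Type u) [CommRing A] : CpTambara.{u} p where
  bot := Cp p → A
  top := A
  weyl := {
    smul := fun g f h => f (h * g)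
    one_smul := fun f => funext fun h => congrArg f (mul_one h)
    mul_smul := fun g g' f => funext fun h => congrArg f (mul_assoc h g g').symm
    smul_zero := fun _ => rfl
    smul_add := fun _ _ _ => rfl
    smul_one := fun _ => rfl
    smul_mul := fun _ _ _ => rfl }
  res := Pi.constRingHom (Cp p) A
  tr := {
    toFun := fun f => ∑ h, f h
    map_zero' := by simp
    map_add' := fun f f' => by simp [Finset.sum_add_distrib] }
  nm := {
    toFun := fun f => ∏ h, f h
    map_one' := by simp
    map_mul' := fun f f' => by simp [Finset.prod_mul_distrib] }
  smul_res _ _ := rfl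
  tr_smul g f := Equiv.sum_comp (Equiv.mulRight g) f
  nm_smul g f := Equiv.prod_comp (Equiv.mulRight g) f
  nm_zero := Finset.prod_eq_zero (Finset.mem_univ 1) rfl
  res_tr f := funext fun h => by
    rw [Finset.sum_apply]
    exact (Equiv.sum_comp (Equiv.mulLeft h) f).symm
  res_nm f := funext fun h => by
    rw [Finset.prod_apply]
    exact (Equiv.prod_comp (Equiv.mulLeft h) f).symm
  tr_mul_res f x := (Finset.sum_mul _ _ _).symm
  nm_add a b := by
    refine (prod_add_eq a b).trans ?_
    congr 1
    refine Finset.sum_congr rfl fun ω _ => Finset.sum_congr rfl fun h _ => ?_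
    simp only [Pi.mul_apply, Finset.prod_apply]
    rfl

/-- The canonical map `R → CoInd_e^{C_p} R(C_p/e)` (the unit of the adjunction between restriction
to the trivial group and coinduction): `a ↦ (g ↦ g • a)` on the level `C_p/e`, and the restriction
on the level `C_p/C_p`. -/
def coindUnit (R : CpTambara.{u} p) : Hom R (coind p R.bot) where
  bot := RingHom.pi fun g => MulSemiringAction.toRingHom (Cp p) R.bot g
  top := R.res
  map_smul g a := funext fun h => (mul_smul h g a).symm
  map_res x := funext fun h => R.smul_res h x
  map_tr a := R.res_tr a
  map_nm a := R.res_nm a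

/-- The canonical map `ghost(R) → CoInd_e^{C_p} R(C_p/e)`; note that
`ghost(R)(C_p/e) = R(C_p/e)`. -/
def ghostToCoind (R : CpTambara.{u} p) : Hom (ghost R) (coind p R.bot) := coindUnit (ghost R)

/-! ### Tambara functors presented by generators

Polynomial algebras and pushouts of Tambara functors are made of formal expressions in generators.
-/

/-- The two levels of a `C_p`-Tambara functor. -/
inductive Level : Type
  | bot : Level
  | top : Level

/-- The ring at a given level. -/
def level (S : CpTambara.{u} p) : Level → Type u
  | Level.bot => S.bot
  | Level.top => S.top

instance (S : CpTambara.{u} p) : (l : Level) → CommRing (S.level l)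
  | Level.bot => S.ringBot
  | Level.top => S.ringTop

instance (S : CpTambara.{u} p) : MulSemiringAction (Cp p) (S.level Level.bot) := S.weyl

/-- Formal expressions in generators `B` on the level `C_p/e` and `T` on the level `C_p/C_p`. -/
inductive Word (p : ℕ) (B T : Type u) : Level → Type u
  | genBot (b : B) : Word p B T Level.bot
  | genTop (t : T) : Word p B T Level.top
  | zero (l : Level) : Word p B T l
  | one (l : Level) : Word p B T l
  | add {l : Level} (v w : Word p B T l) : Word p B T l
  | mul {l : Level} (v w : Word p B T l) : Word p B T l
  | neg {l : Level} (w : Word p B T l) : Word p B T l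
  | smul (g : Cp p) (w : Word p B T Level.bot) : Word p B T Level.bot
  | res (w : Word p B T Level.top) : Word p B T Level.bot
  | tr (w : Word p B T Level.bot) : Word p B T Level.top
  | nm (w : Word p B T Level.bot) : Word p B T Level.top

/-- The value of an expression when the generators are interpreted in `S`. -/
def Word.eval {B T : Type u} (S : CpTambara.{u} p) (β : B → S.bot) (τ : T → S.top) :
    {l : Level} → Word p B T l → S.level l
  | _, Word.genBot b => β b
  | _, Word.genTop t => τ t
  | _, Word.zero _ => 0
  | _, Word.one _ => 1
  | _, Word.add v w => Word.eval S β τ v + Word.eval S β τ w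
  | _, Word.mul v w => Word.eval S β τ v * Word.eval S β τ w
  | _, Word.neg w => - Word.eval S β τ w
  | _, Word.smul g w => g • Word.eval S β τ w
  | _, Word.res w => S.res (Word.eval S β τ w)
  | _, Word.tr w => S.tr (Word.eval S β τ w)
  | _, Word.nm w => S.nm (Word.eval S β τ w)

/-- A class of interpretations of the generators `B` and `T` in Tambara functors. -/
abbrev Interp (p : ℕ) [Fact p.Prime] (B T : Type u) : Type (u + 1) :=
  (S : CpTambara.{u} p) → (B → S.bot) → (T → S.top) → Prop

section Presented

variable {B T : Type u} (K : Interp p B T)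

/-- Two expressions are identified when they have the same value under all interpretations in the
class `K`. -/
def wordSetoid (l : Level) : Setoid (Word p B T l) where
  r v w := ∀ (S : CpTambara.{u} p) (β : B → S.bot) (τ : T → S.top), K S β τ →
    v.eval S β τ = w.eval S β τ
  iseqv := ⟨fun _ _ _ _ _ => rfl, fun h S β τ k => (h S β τ k).symm,
    fun h h' S β τ k => (h S β τ k).trans (h' S β τ k)⟩

/-- One level of the presented Tambara functor. -/
def Presented (l : Level) : Type u := Quotient (wordSetoid K l)

namespace Presented

/-- The class of an expression. -/
def mk {l : Level} (w : Word p B T l) : Presented K l := Quotient.mk (wordSetoid K l) w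

variable {K}

/-- The value of an element of the presented Tambara functor under an interpretation. -/
def val {S : CpTambara.{u} p} {β : B → S.bot} {τ : T → S.top} (k : K S β τ) {l : Level} :
    Presented K l → S.level l :=
  Quotient.lift (fun w => w.eval S β τ) fun _ _ h => h S β τ k

theorem ext_val {l : Level} {x y : Presented K l}
    (h : ∀ (S : CpTambara.{u} p) (β : B → S.bot) (τ : T → S.top) (k : K S β τ),
      val k x = val k y) : x = y := by
  induction x using Quotient.ind
  induction y using Quotient.ind
  exact Quotient.sound fun S β τ k => h S β τ k

instance (l : Level) : Zero (Presented K l) := ⟨mk K (Word.zero l)⟩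
instance (l : Level) : One (Presented K l) := ⟨mk K (Word.one l)⟩
instance (l : Level) : Add (Presented K l) := ⟨Quotient.map₂ Word.add
  fun _ _ h _ _ h' S β τ k => congrArg₂ (· + ·) (h S β τ k) (h' S β τ k)⟩
instance (l : Level) : Mul (Presented K l) := ⟨Quotient.map₂ Word.mul
  fun _ _ h _ _ h' S β τ k => congrArg₂ (· * ·) (h S β τ k) (h' S β τ k)⟩
instance (l : Level) : Neg (Presented K l) := ⟨Quotient.map Word.neg
  fun _ _ h S β τ k => congrArg (- ·) (h S β τ k)⟩
instance : SMul (Cp p) (Presented K Level.bot) := ⟨fun g => Quotient.map (Word.smul g)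
  fun _ _ h S β τ k => congrArg (g • ·) (h S β τ k)⟩

/-- The restriction of the presented Tambara functor. -/
def resFun : Presented K Level.top → Presented K Level.bot := Quotient.map Word.res
  fun _ _ h S β τ k => congrArg S.res (h S β τ k)
/-- The transfer of the presented Tambara functor. -/
def trFun : Presented K Level.bot → Presented K Level.top := Quotient.map Word.tr
  fun _ _ h S β τ k => congrArg S.tr (h S β τ k)
/-- The norm of the presented Tambara functor. -/
def nmFun : Presented K Level.bot → Presented K Level.top := Quotient.map Word.nm
  fun _ _ h S β τ k => congrArg S.nm (h S β τ k)

section val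

variable {S : CpTambara.{u} p} {β : B → S.bot} {τ : T → S.top} (k : K S β τ)

theorem val_zero {l : Level} : val k (0 : Presented K l) = 0 := rfl
theorem val_one {l : Level} : val k (1 : Presented K l) = 1 := rfl
theorem val_add {l : Level} (x y : Presented K l) : val k (x + y) = val k x + val k y := by
  induction x using Quotient.ind
  induction y using Quotient.ind
  rfl
theorem val_mul {l : Level} (x y : Presented K l) : val k (x * y) = val k x * val k y := by
  induction x using Quotient.ind
  induction y using Quotient.ind
  rfl
theorem val_neg {l : Level} (x : Presented K l) : val k (-x) = -val k x := by
  induction x using Quotient.ind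
  rfl
theorem val_smul (g : Cp p) (x : Presented K Level.bot) :
    val k (g • x) = g • val k x := by
  induction x using Quotient.ind
  rfl
theorem val_res (x : Presented K Level.top) : val k (resFun x) = S.res (val k x) := by
  induction x using Quotient.ind
  rfl
theorem val_tr (x : Presented K Level.bot) : val k (trFun x) = S.tr (val k x) := by
  induction x using Quotient.ind
  rfl
theorem val_nm (x : Presented K Level.bot) : val k (nmFun x) = S.nm (val k x) := by
  induction x using Quotient.ind
  rfl

end val

instance (l : Level) : CommRing (Presented K l) where
  add_assoc x y z := ext_val fun S β τ k => by simp only [val_add, add_assoc]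
  zero_add x := ext_val fun S β τ k => by simp only [val_add, val_zero, zero_add]
  add_zero x := ext_val fun S β τ k => by simp only [val_add, val_zero, add_zero]
  add_comm x y := ext_val fun S β τ k => by simp only [val_add, add_comm]
  left_distrib x y z := ext_val fun S β τ k => by simp only [val_add, val_mul, mul_add]
  right_distrib x y z := ext_val fun S β τ k => by simp only [val_add, val_mul, add_mul]
  zero_mul x := ext_val fun S β τ k => by simp only [val_mul, val_zero, zero_mul]
  mul_zero x := ext_val fun S β τ k => by simp only [val_mul, val_zero, mul_zero]
  mul_assoc x y z := ext_val fun S β τ k => by simp only [val_mul, mul_assoc]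
  one_mul x := ext_val fun S β τ k => by simp only [val_mul, val_one, one_mul]
  mul_one x := ext_val fun S β τ k => by simp only [val_mul, val_one, mul_one]
  mul_comm x y := ext_val fun S β τ k => by simp only [val_mul, mul_comm]
  neg_add_cancel x := ext_val fun S β τ k => by
    simp only [val_add, val_neg, val_zero, neg_add_cancel]
  nsmul := nsmulRec
  zsmul := zsmulRec

/-- Evaluation as a ring homomorphism. -/
def valHom {S : CpTambara.{u} p} {β : B → S.bot} {τ : T → S.top} (k : K S β τ) (l : Level) :
    Presented K l →+* S.level l where
  toFun := val k
  map_zero' := val_zero k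
  map_one' := val_one k
  map_add' := val_add k
  map_mul' := val_mul k

theorem val_sum {S : CpTambara.{u} p} {β : B → S.bot} {τ : T → S.top} (k : K S β τ) {l : Level}
    {ι : Type*} (s : Finset ι) (f : ι → Presented K l) :
    val k (∑ i ∈ s, f i) = ∑ i ∈ s, val k (f i) := map_sum (valHom k l) f s

theorem val_prod {S : CpTambara.{u} p} {β : B → S.bot} {τ : T → S.top} (k : K S β τ) {l : Level}
    {ι : Type*} (s : Finset ι) (f : ι → Presented K l) :
    val k (∏ i ∈ s, f i) = ∏ i ∈ s, val k (f i) := map_prod (valHom k l) f s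

end Presented

open Presented in
/-- The Tambara functor presented by generators `B` and `T` that is universal for the class of
interpretations `K`: its elements are the formal expressions in the generators modulo the equations
that hold under all interpretations in the class. -/
def presented : CpTambara.{u} p where
  bot := Presented K Level.bot
  top := Presented K Level.top
  weyl := {
    one_smul := fun x => ext_val fun S β τ k => by
      rw [val_smul]; exact one_smul _ _
    mul_smul := fun g h x => ext_val fun S β τ k => by
      simp only [val_smul]; exact mul_smul g h _
    smul_zero := fun g => ext_val fun S β τ k => by
      rw [val_smul]; exact smul_zero g
    smul_add := fun g x y => ext_val fun S β τ k => by
      simp only [val_smul, val_add]; exact smul_add g _ _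
    smul_one := fun g => ext_val fun S β τ k => by
      rw [val_smul]; exact smul_one g
    smul_mul := fun g x y => ext_val fun S β τ k => by
      simp only [val_smul, val_mul]; exact smul_mul' g _ _ }
  res := {
    toFun := resFun
    map_zero' := ext_val fun S β τ k => by rw [val_res]; exact map_zero S.res
    map_one' := ext_val fun S β τ k => by rw [val_res]; exact map_one S.res
    map_add' := fun x y => ext_val fun S β τ k => by
      simp only [val_res, val_add]; exact map_add S.res _ _
    map_mul' := fun x y => ext_val fun S β τ k => by
      simp only [val_res, val_mul]; exact map_mul S.res _ _ }
  tr := {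
    toFun := trFun
    map_zero' := ext_val fun S β τ k => by rw [val_tr]; exact map_zero S.tr
    map_add' := fun x y => ext_val fun S β τ k => by
      simp only [val_tr, val_add]; exact map_add S.tr _ _ }
  nm := {
    toFun := nmFun
    map_one' := ext_val fun S β τ k => by rw [val_nm]; exact map_one S.nm
    map_mul' := fun x y => ext_val fun S β τ k => by
      simp only [val_nm, val_mul]; exact map_mul S.nm _ _ }
  smul_res g x := ext_val fun S β τ k => by
    rw [val_smul]
    change g • val k (resFun x) = val k (resFun x)
    rw [val_res]
    exact S.smul_res g _
  tr_smul g a := ext_val fun S β τ k => by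
    change val k (trFun (g • a)) = val k (trFun a)
    rw [val_tr, val_tr, val_smul]
    exact S.tr_smul g _
  nm_smul g a := ext_val fun S β τ k => by
    change val k (nmFun (g • a)) = val k (nmFun a)
    rw [val_nm, val_nm, val_smul]
    exact S.nm_smul g _
  nm_zero := ext_val fun S β τ k => by
    change val k (nmFun 0) = _
    rw [val_nm]
    exact S.nm_zero
  res_tr a := ext_val fun S β τ k => by
    change val k (resFun (trFun a)) = _
    rw [val_res, val_tr, val_sum]
    simp only [val_smul]
    exact S.res_tr _
  res_nm a := ext_val fun S β τ k => by
    change val k (resFun (nmFun a)) = _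
    rw [val_res, val_nm, val_prod]
    simp only [val_smul]
    exact S.res_nm _
  tr_mul_res a x := ext_val fun S β τ k => by
    change val k (trFun (a * resFun x)) = val k (trFun a * x)
    rw [val_tr, val_mul, val_mul, val_tr, val_res]
    exact S.tr_mul_res _ _
  nm_add a b := ext_val fun S β τ k => by
    change val k (nmFun (a + b)) = val k (nmFun a + nmFun b + ∑ ω : MixedOrbit p,
      trFun ((∏ g ∈ ω.rep, g • a) * ∏ g ∈ (ω.rep)ᶜ, g • b))
    simp only [val_nm, val_add, val_sum, val_tr, val_mul, val_prod, val_smul]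
    exact S.nm_add _ _

/-- An interpretation in the class extends to a morphism. -/
def presentedLift {K : Interp p B T} {S : CpTambara.{u} p} {β : B → S.bot} {τ : T → S.top}
    (k : K S β τ) : Hom (presented K) S where
  bot := Presented.valHom k Level.bot
  top := Presented.valHom k Level.top
  map_smul := Presented.val_smul k
  map_res := Presented.val_res k
  map_tr := Presented.val_tr k
  map_nm := Presented.val_nm k

/-- If all interpretations in the class restrict to morphisms out of `R`, along maps from `R` to
the generators, then so do the classes of the generators. -/
def presentedOf {K : Interp p B T} {R : CpTambara.{u} p} (i : R.bot → B) (j : R.top → T)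
    (h : ∀ (S : CpTambara.{u} p) (β : B → S.bot) (τ : T → S.top), K S β τ →
      ∃ φ : Hom R S, (∀ a, β (i a) = φ.bot a) ∧ ∀ x, τ (j x) = φ.top x) :
    Hom R (presented K) where
  bot := {
    toFun := fun a => Presented.mk K (Word.genBot (i a))
    map_zero' := Quotient.sound fun S β τ k => by
      obtain ⟨φ, h1, h2⟩ := h S β τ k
      exact (h1 _).trans (map_zero φ.bot)
    map_one' := Quotient.sound fun S β τ k => by
      obtain ⟨φ, h1, h2⟩ := h S β τ k
      exact (h1 _).trans (map_one φ.bot)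
    map_add' := fun a b => Quotient.sound fun S β τ k => by
      obtain ⟨φ, h1, h2⟩ := h S β τ k
      change β (i (a + b)) = β (i a) + β (i b)
      rw [h1, h1, h1, map_add]
    map_mul' := fun a b => Quotient.sound fun S β τ k => by
      obtain ⟨φ, h1, h2⟩ := h S β τ k
      change β (i (a * b)) = β (i a) * β (i b)
      rw [h1, h1, h1, map_mul] }
  top := {
    toFun := fun x => Presented.mk K (Word.genTop (j x))
    map_zero' := Quotient.sound fun S β τ k => by
      obtain ⟨φ, h1, h2⟩ := h S β τ k
      exact (h2 _).trans (map_zero φ.top)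
    map_one' := Quotient.sound fun S β τ k => by
      obtain ⟨φ, h1, h2⟩ := h S β τ k
      exact (h2 _).trans (map_one φ.top)
    map_add' := fun a b => Quotient.sound fun S β τ k => by
      obtain ⟨φ, h1, h2⟩ := h S β τ k
      change τ (j (a + b)) = τ (j a) + τ (j b)
      rw [h2, h2, h2, map_add]
    map_mul' := fun a b => Quotient.sound fun S β τ k => by
      obtain ⟨φ, h1, h2⟩ := h S β τ k
      change τ (j (a * b)) = τ (j a) * τ (j b)
      rw [h2, h2, h2, map_mul] }
  map_smul g a := Quotient.sound fun S β τ k => by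
    obtain ⟨φ, h1, h2⟩ := h S β τ k
    change β (i (g • a)) = g • β (i a)
    rw [h1, h1, φ.map_smul]
  map_res x := Quotient.sound fun S β τ k => by
    obtain ⟨φ, h1, h2⟩ := h S β τ k
    change β (i (R.res x)) = S.res (τ (j x))
    rw [h1, h2, φ.map_res]
  map_tr a := Quotient.sound fun S β τ k => by
    obtain ⟨φ, h1, h2⟩ := h S β τ k
    change τ (j (R.tr a)) = S.tr (β (i a))
    rw [h1, h2, φ.map_tr]
  map_nm a := Quotient.sound fun S β τ k => by
    obtain ⟨φ, h1, h2⟩ := h S β τ k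
    change τ (j (R.nm a)) = S.nm (β (i a))
    rw [h1, h2, φ.map_nm]

end Presented

/-! ### Morphisms of finite presentation -/

/-- The polynomial algebra over `R` on `m` generators on the level `C_p/e` and `n` generators on
the level `C_p/C_p`: it is universal among the Tambara functors with a morphism from `R` and with
chosen elements `m` on the level `C_p/e` and `n` on the level `C_p/C_p`. -/
def poly (R : CpTambara.{u} p) (m n : ℕ) : CpTambara.{u} p :=
  presented (B := R.bot ⊕ Fin m) (T := R.top ⊕ Fin n) fun S β τ =>
    ∃ φ : Hom R S, (∀ a, β (Sum.inl a) = φ.bot a) ∧ ∀ x, τ (Sum.inl x) = φ.top x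

/-- The structure morphism of the polynomial algebra. -/
def polyC (R : CpTambara.{u} p) (m n : ℕ) : Hom R (poly R m n) :=
  presentedOf Sum.inl Sum.inl fun _ _ _ k => k

/-- `S` is isomorphic, as an algebra over `R`, to the quotient of a polynomial algebra on finitely
many generators by a finitely generated Tambara ideal. -/
def Hom.FinitelyPresented {R S : CpTambara.{u} p} (f : Hom R S) : Prop :=
  ∃ (m n : ℕ) (π : Hom (poly R m n) S), π.comp (polyC R m n) = f ∧
    Function.Surjective π.bot ∧ Function.Surjective π.top ∧ π.ker.FG

/-! ### Modules, box products and flatness -/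

/-- A module over (the Green functor underlying) the Tambara functor `R`: a Mackey functor with
levels `bot = M(C_p/e)` and `top = M(C_p/C_p)` and an action of `R`. -/
structure Mod (R : CpTambara.{u} p) : Type (u + 1) where
  bot : Type u
  top : Type u
  [groupBot : AddCommGroup bot]
  [groupTop : AddCommGroup top]
  [moduleBot : Module R.bot bot]
  [moduleTop : Module R.top top]
  [weyl : DistribMulAction (Cp p) bot]
  res : top →+ bot
  tr : bot →+ top
  weyl_smul : ∀ (g : Cp p) (a : R.bot) (m : bot), g • (a • m) = (g • a) • (g • m)
  weyl_res : ∀ (g : Cp p) (y : top), g • res y = res y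
  tr_weyl : ∀ (g : Cp p) (m : bot), tr (g • m) = tr m
  res_tr : ∀ m : bot, res (tr m) = ∑ g : Cp p, g • m
  res_smul : ∀ (x : R.top) (y : top), res (x • y) = R.res x • res y
  tr_res_smul : ∀ (x : R.top) (m : bot), tr (R.res x • m) = x • tr m
  tr_smul_res : ∀ (a : R.bot) (y : top), tr (a • res y) = R.tr a • y

attribute [instance] Mod.groupBot Mod.groupTop Mod.moduleBot Mod.moduleTop Mod.weyl

namespace Mod

variable {R : CpTambara.{u} p}

/-- A morphism of modules over `R`. -/
structure Hom (M N : Mod R) : Type u where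
  bot : M.bot →ₗ[R.bot] N.bot
  top : M.top →ₗ[R.top] N.top
  map_weyl : ∀ (g : Cp p) (m : M.bot), bot (g • m) = g • bot m
  map_res : ∀ y : M.top, bot (M.res y) = N.res (top y)
  map_tr : ∀ m : M.bot, top (M.tr m) = N.tr (bot m)

/-- The level `C_p/e` of the box product of `M` and `N` over `R`. -/
abbrev boxBot (M N : Mod R) : Type u := M.bot ⊗[R.bot] N.bot

/-- The relations on the level `C_p/C_p` of the box product, where the second summand stands for
the transfers: Frobenius reciprocity in both variables, and invariance of the transfer. -/
def boxRel (M N : Mod R) : AddSubgroup ((M.top ⊗[R.top] N.top) × (M.bot ⊗[R.bot] N.bot)) :=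
  AddSubgroup.closure
    ({z | ∃ (y : M.top) (n : N.bot), z = (y ⊗ₜ N.tr n, -(M.res y ⊗ₜ n))} ∪
     {z | ∃ (m : M.bot) (y : N.top), z = (M.tr m ⊗ₜ y, -(m ⊗ₜ N.res y))} ∪
     {z | ∃ (g : Cp p) (m : M.bot) (n : N.bot), z = (0, (g • m) ⊗ₜ (g • n) - m ⊗ₜ n)})

/-- The level `C_p/C_p` of the box product of `M` and `N` over `R`. -/
abbrev boxTop (M N : Mod R) : Type u :=
  ((M.top ⊗[R.top] N.top) × (M.bot ⊗[R.bot] N.bot)) ⧸ boxRel M N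

/-- The map induced on the level `C_p/e` of box products. -/
def boxMapBot {M M' : Mod R} (f : Hom M M') (N : Mod R) : boxBot M N →+ boxBot M' N :=
  (f.bot.rTensor N.bot).toAddMonoidHom

/-- The map induced on the level `C_p/C_p` of box products. -/
def boxMapTop {M M' : Mod R} (f : Hom M M') (N : Mod R) : boxTop M N →+ boxTop M' N :=
  QuotientAddGroup.map (boxRel M N) (boxRel M' N)
    (AddMonoidHom.prodMap (f.top.rTensor N.top).toAddMonoidHom
      (f.bot.rTensor N.bot).toAddMonoidHom) (by
    rw [boxRel, AddSubgroup.closure_le]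
    rintro _ ((⟨y, n, rfl⟩ | ⟨m, y, rfl⟩) | ⟨g, m, n, rfl⟩)
    · refine AddSubgroup.subset_closure (Or.inl (Or.inl ⟨f.top y, n, ?_⟩))
      simp [f.map_res]
    · refine AddSubgroup.subset_closure (Or.inl (Or.inr ⟨f.bot m, y, ?_⟩))
      simp [f.map_tr]
    · refine AddSubgroup.subset_closure (Or.inr ⟨g, f.bot m, n, ?_⟩)
      simp [f.map_weyl])

/-- The module `N` is flat: the functor that takes the box product with `N` over `R` is exact. -/
def Flat (N : Mod R) : Prop :=
  ∀ (M M' M'' : Mod R) (f : Hom M M') (g : Hom M' M''),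
    Function.Exact f.bot g.bot → Function.Exact f.top g.top →
      Function.Exact (boxMapBot f N) (boxMapBot g N) ∧
        Function.Exact (boxMapTop f N) (boxMapTop g N)

end Mod

/-- The target of a morphism `f` as a module over its source. -/
def Hom.toMod {R S : CpTambara.{u} p} (f : Hom R S) : Mod R where
  bot := S.bot
  top := S.top
  moduleBot := Module.compHom S.bot f.bot
  moduleTop := Module.compHom S.top f.top
  res := S.res.toAddMonoidHom
  tr := S.tr
  weyl_smul g a m := by
    change g • (f.bot a * m) = f.bot (g • a) * g • m
    rw [smul_mul', f.map_smul]
  weyl_res := S.smul_res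
  tr_weyl := S.tr_smul
  res_tr := S.res_tr
  res_smul x y := by
    change S.res (f.top x * y) = f.bot (R.res x) * S.res y
    rw [map_mul, f.map_res]
  tr_res_smul x m := by
    change S.tr (f.bot (R.res x) * m) = f.top x * S.tr m
    rw [f.map_res, mul_comm, S.tr_mul_res, mul_comm]
  tr_smul_res a y := by
    change S.tr (f.bot a * S.res y) = f.top (R.tr a) * y
    rw [f.map_tr, S.tr_mul_res]

/-! ### Genuine Kähler differentials -/

/-- The box product `S □_R S` of the algebra `S` over `R` with itself, as a Tambara functor. It is
the coproduct of two copies of the algebra `S`: the Tambara functor that is universal for two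
morphisms from `S` which agree on `R`. -/
def boxSelf {R S : CpTambara.{u} p} (f : Hom R S) : CpTambara.{u} p :=
  presented (B := S.bot ⊕ S.bot) (T := S.top ⊕ S.top) fun Q β τ =>
    ∃ φ ψ : Hom S Q, φ.comp f = ψ.comp f ∧
      β = Sum.elim φ.bot ψ.bot ∧ τ = Sum.elim φ.top ψ.top

/-- The multiplication `S □_R S → S`. -/
def boxSelfMul {R S : CpTambara.{u} p} (f : Hom R S) : Hom (boxSelf f) S :=
  presentedLift (β := Sum.elim (Hom.id S).bot (Hom.id S).bot)
    (τ := Sum.elim (Hom.id S).top (Hom.id S).top) ⟨Hom.id S, Hom.id S, rfl, rfl, rfl⟩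

/-- The ideal `I^{>1}` generated by the products and the norms of elements of `I`. -/
def TIdeal.decomposables {R : CpTambara.{u} p} (I : TIdeal R) : TIdeal R :=
  TIdeal.span (Set.image2 (fun a b => a * b) (I.bot : Set R.bot) (I.bot : Set R.bot))
    (Set.image2 (fun x y => x * y) (I.top : Set R.top) (I.top : Set R.top) ∪
      R.nm '' (I.bot : Set R.bot))

/-- The level `C_p/e` of the genuine Kähler differentials `I/I^{>1}`, where `I` is the kernel of
the multiplication `S □_R S → S`. -/
abbrev kaehlerBot {R S : CpTambara.{u} p} (f : Hom R S) : Type u :=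
  (boxSelfMul f).ker.bot ⧸
    Submodule.comap (Submodule.subtype (boxSelfMul f).ker.bot)
       (boxSelfMul f).ker.decomposables.bot

/-- The level `C_p/C_p` of the genuine Kähler differentials `I/I^{>1}`. -/
abbrev kaehlerTop {R S : CpTambara.{u} p} (f : Hom R S) : Type u :=
  (boxSelfMul f).ker.top ⧸
    Submodule.comap (Submodule.subtype (boxSelfMul f).ker.top)
       (boxSelfMul f).ker.decomposables.top

/-- An étale morphism: finitely presented, flat, with vanishing genuine Kähler differentials. -/
structure Hom.Etale {R S : CpTambara.{u} p} (f : Hom R S) : Prop where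
  finitelyPresented : f.FinitelyPresented
  flat : f.toMod.Flat
  kaehlerBot : Subsingleton (kaehlerBot f)
  kaehlerTop : Subsingleton (kaehlerTop f)

end CpTambara

namespace CpTambara

variable {p : ℕ} [Fact p.Prime]

/-! Étaleness has nothing to do with the ghost: for every Tambara functor `G` the map `coindUnit G`
is étale, and the theorem uses this for the ghost, whose level `C_p/e` is `R.bot`. The target is the
`G`-algebra of functions on the free orbit, and everything rests on one element of it, `coindDelta`,
the indicator function of the neutral element. Its translates are orthogonal idempotents with sum
`1`, and its transfer is `1`; an element with these properties is an `IsFreeIdempotent`. Such an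
element `e` of `S` identifies `S.top` with `e * S.bot` through `x ↦ e * S.res x`, so it yields a map
from the coinduction to `S` extending any given `G → S` (`coindLift`). The map is unique, since
`coindDelta` generates the coinduction over `G` (`coind_hom_ext`). Hence the coinduction is `G` with
one generator on level `C_p/e` and finitely many relations.

The same universal property kills the Kähler differentials. The two copies of `coindDelta` in the
box square are commuting idempotents `e`, `e'`, so `e - e'` equals its own cube and is decomposable.
Modulo decomposables the two coprojections therefore agree, which puts the whole kernel of
multiplication inside the decomposables.

For flatness, level `C_p/e` of the coinduction is a finite product of twisted copies of `G.bot`,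
hence free. On level `C_p/C_p`, boxing `M` with the coinduction gives back `M.bot` (`boxTopEquiv`):
every class can be rewritten as the transfer of some `m ⊗ coindDelta`. Both levels thus preserve
exactness.

Failure of openness comes from the second factor of the ghost. It is nonzero because the transfer is
not surjective, so it has a maximal ideal `q`. The norm modulo transfers is a ring homomorphism, and
pulling `q` back along it gives a prime `ghostIdeal q` of the ghost that omits `(0, 1)`. Every prime
in the image of the spectrum contains `(0, 1)`, which restricts to `0`. But `ghostIdeal q` lies
below a prime in the image, and open sets are stable under passing to smaller primes, so the image
is not open. -/

theorem mem_bot_ker {R S : CpTambara.{u} p} (f : Hom R S) {a : R.bot} :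
    a ∈ f.ker.bot ↔ f.bot a = 0 := Iff.rfl

theorem mem_top_ker {R S : CpTambara.{u} p} (f : Hom R S) {x : R.top} :
    x ∈ f.ker.top ↔ f.top x = 0 := Iff.rfl

/-! ### Quotients by Tambara ideals -/

namespace TIdeal

variable {R : CpTambara.{u} p}

/-- This makes the norm well defined on a quotient, although it is not additive. -/
theorem nm_sub_nm_mem (I : TIdeal R) {a b : R.bot} (h : a - b ∈ I.bot) :
    R.nm a - R.nm b ∈ I.top := by
  have e : R.nm a = R.nm ((a - b) + b) := by rw [sub_add_cancel]
  rw [e, R.nm_add, add_right_comm, add_sub_cancel_right]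
  refine I.top.add_mem (I.nm_mem h) (Ideal.sum_mem _ fun ω _ => I.tr_mem ?_)
  -- The representative of the orbit is nonempty, so each cross term has a translate of `a - b` as a
  -- factor.
  obtain ⟨g, hg⟩ := (Quotient.out ω : MixedSubset p).2.1
  exact Ideal.mul_mem_right _ _ (Ideal.prod_mem _ hg (I.smul_mem g h))

/-- The action of `C_p` on the level `C_p/e` of a quotient. -/
def quotientSMul (I : TIdeal R) (g : Cp p) : R.bot ⧸ I.bot →+* R.bot ⧸ I.bot :=
  Ideal.quotientMap I.bot (MulSemiringAction.toRingHom (Cp p) R.bot g) fun _ h => I.smul_mem g h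

/-- The quotient of a Tambara functor by a Tambara ideal. -/
def quotient (I : TIdeal R) : CpTambara.{u} p where
  bot := R.bot ⧸ I.bot
  top := R.top ⧸ I.top
  weyl := {
    smul := fun g => I.quotientSMul g
    one_smul := fun x => by
      obtain ⟨a, rfl⟩ := Ideal.Quotient.mk_surjective x
      exact congrArg (Ideal.Quotient.mk I.bot) (one_smul (Cp p) a)
    mul_smul := fun g h x => by
      obtain ⟨a, rfl⟩ := Ideal.Quotient.mk_surjective x
      exact congrArg (Ideal.Quotient.mk I.bot) (mul_smul g h a)
    smul_zero := fun g => map_zero (I.quotientSMul g)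
    smul_add := fun g => map_add (I.quotientSMul g)
    smul_one := fun g => map_one (I.quotientSMul g)
    smul_mul := fun g => map_mul (I.quotientSMul g) }
  res := Ideal.quotientMap I.bot R.res fun _ h => I.res_mem h
  tr := QuotientAddGroup.map I.bot.toAddSubgroup I.top.toAddSubgroup R.tr
    fun _ h => I.tr_mem h
  nm := {
    toFun := Quotient.lift (fun a => Ideal.Quotient.mk I.top (R.nm a)) fun a b h =>
      Ideal.Quotient.eq.2 (I.nm_sub_nm_mem ((Submodule.quotientRel_def _).1 h))
    map_one' := congrArg (Ideal.Quotient.mk I.top) R.nm.map_one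
    map_mul' := fun x y => by
      obtain ⟨a, rfl⟩ := Ideal.Quotient.mk_surjective x
      obtain ⟨b, rfl⟩ := Ideal.Quotient.mk_surjective y
      exact congrArg (Ideal.Quotient.mk I.top) (R.nm.map_mul a b) }
  smul_res g x := by
    obtain ⟨x, rfl⟩ := Ideal.Quotient.mk_surjective x
    exact congrArg (Ideal.Quotient.mk I.bot) (R.smul_res g x)
  tr_smul g x := by
    obtain ⟨a, rfl⟩ := Ideal.Quotient.mk_surjective x
    exact congrArg (Ideal.Quotient.mk I.top) (R.tr_smul g a)
  nm_smul g x := by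
    obtain ⟨a, rfl⟩ := Ideal.Quotient.mk_surjective x
    exact congrArg (Ideal.Quotient.mk I.top) (R.nm_smul g a)
  nm_zero := congrArg (Ideal.Quotient.mk I.top) R.nm_zero
  res_tr x := by
    obtain ⟨a, rfl⟩ := Ideal.Quotient.mk_surjective x
    exact (congrArg (Ideal.Quotient.mk I.bot) (R.res_tr a)).trans (map_sum _ _ _)
  res_nm x := by
    obtain ⟨a, rfl⟩ := Ideal.Quotient.mk_surjective x
    exact (congrArg (Ideal.Quotient.mk I.bot) (R.res_nm a)).trans (map_prod _ _ _)
  tr_mul_res x y := by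
    obtain ⟨a, rfl⟩ := Ideal.Quotient.mk_surjective x
    obtain ⟨y, rfl⟩ := Ideal.Quotient.mk_surjective y
    exact congrArg (Ideal.Quotient.mk I.top) (R.tr_mul_res a y)
  nm_add x y := by
    obtain ⟨a, rfl⟩ := Ideal.Quotient.mk_surjective x
    obtain ⟨b, rfl⟩ := Ideal.Quotient.mk_surjective y
    refine (congrArg (Ideal.Quotient.mk I.top) (R.nm_add a b)).trans ?_
    rw [map_add, map_add, map_sum]
    refine congrArg₂ (· + ·) rfl (Finset.sum_congr rfl fun ω _ => ?_)
    refine (?_ : _ = QuotientAddGroup.map _ I.top.toAddSubgroup R.tr (fun _ h => I.tr_mem h)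
      (Ideal.Quotient.mk I.bot ((∏ g ∈ ω.rep, g • a) * ∏ g ∈ (ω.rep)ᶜ, g • b))).trans ?_
    · rfl
    · rw [map_mul, map_prod, map_prod]
      rfl

/-- The projection to the quotient by a Tambara ideal. -/
def quotientMk (I : TIdeal R) : Hom R I.quotient where
  bot := Ideal.Quotient.mk I.bot
  top := Ideal.Quotient.mk I.top
  map_smul _ _ := rfl
  map_res _ := rfl
  map_tr _ := rfl
  map_nm _ := rfl

theorem quotientMk_bot_eq_zero {I : TIdeal R} {a : R.bot} : I.quotientMk.bot a = 0 ↔ a ∈ I.bot :=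
  Ideal.Quotient.eq_zero_iff_mem

theorem quotientMk_top_eq_zero {I : TIdeal R} {x : R.top} : I.quotientMk.top x = 0 ↔ x ∈ I.top :=
  Ideal.Quotient.eq_zero_iff_mem

/-- If the projection to the quotient by `I` factors through `f`, then `I` contains the kernel
of `f`. -/
theorem ker_le_of_comp_eq {S : CpTambara.{u} p} {I : TIdeal R} {f : Hom R S}
    {k : Hom S I.quotient} (h : k.comp f = I.quotientMk) : f.ker ≤ I := by
  constructor
  · intro a ha
    rw [← quotientMk_bot_eq_zero, ← h]
    exact (congrArg k.bot ((mem_bot_ker f).1 ha)).trans (map_zero k.bot)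
  · intro x hx
    rw [← quotientMk_top_eq_zero, ← h]
    exact (congrArg k.top ((mem_top_ker f).1 hx)).trans (map_zero k.top)

theorem subset_span_bot {s : Set R.bot} {t : Set R.top} : s ⊆ (span s t).bot :=
  (span_le.1 (⟨le_rfl, le_rfl⟩ : span s t ≤ span s t)).1

theorem subset_span_top {s : Set R.bot} {t : Set R.top} : t ⊆ (span s t).top :=
  (span_le.1 (⟨le_rfl, le_rfl⟩ : span s t ≤ span s t)).2

theorem le_antisymm {I J : TIdeal R} (h : I ≤ J) (h' : J ≤ I) : I = J :=
  TIdeal.ext (_root_.le_antisymm h.1 h'.1) (_root_.le_antisymm h.2 h'.2)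

end TIdeal

/-! ### Morphisms out of presented Tambara functors -/

/-- Morphisms out of a presented Tambara functor agree if they agree on the generators. -/
theorem presented_hom_ext {B T : Type u} {K : Interp p B T} {S : CpTambara.{u} p}
    {φ ψ : Hom (presented K) S}
    (hB : ∀ b, φ.bot (Presented.mk K (Word.genBot b)) = ψ.bot (Presented.mk K (Word.genBot b)))
    (hT : ∀ t, φ.top (Presented.mk K (Word.genTop t)) = ψ.top (Presented.mk K (Word.genTop t))) :
    φ = ψ := by
  -- The two levels of a morphism are separate maps, so the induction on expressions needs a motive
  -- that branches on the level.
  let P : (l : Level) → Word p B T l → Prop := fun l => match l with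
    | Level.bot => fun w => φ.bot (Presented.mk K w) = ψ.bot (Presented.mk K w)
    | Level.top => fun w => φ.top (Presented.mk K w) = ψ.top (Presented.mk K w)
  have key : ∀ l w, P l w := by
    intro l w
    induction w with
    | genBot b => exact hB b
    | genTop t => exact hT t
    | zero l =>
      cases l
      · exact (map_zero φ.bot).trans (map_zero ψ.bot).symm
      · exact (map_zero φ.top).trans (map_zero ψ.top).symm
    | one l =>
      cases l
      · exact (map_one φ.bot).trans (map_one ψ.bot).symm
      · exact (map_one φ.top).trans (map_one ψ.top).symm
    | @add l v w hv hw =>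
      cases l
      · exact (map_add φ.bot _ _).trans ((congrArg₂ (· + ·) hv hw).trans (map_add ψ.bot _ _).symm)
      · exact (map_add φ.top _ _).trans ((congrArg₂ (· + ·) hv hw).trans (map_add ψ.top _ _).symm)
    | @mul l v w hv hw =>
      cases l
      · exact (map_mul φ.bot _ _).trans ((congrArg₂ (· * ·) hv hw).trans (map_mul ψ.bot _ _).symm)
      · exact (map_mul φ.top _ _).trans ((congrArg₂ (· * ·) hv hw).trans (map_mul ψ.top _ _).symm)
    | @neg l w hw =>
      cases l
      · exact (map_neg φ.bot _).trans ((congrArg (- ·) hw).trans (map_neg ψ.bot _).symm)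
      · exact (map_neg φ.top _).trans ((congrArg (- ·) hw).trans (map_neg ψ.top _).symm)
    | smul g w hw =>
      exact (φ.map_smul g _).trans ((congrArg (g • ·) hw).trans (ψ.map_smul g _).symm)
    | res w hw => exact (φ.map_res _).trans ((congrArg S.res hw).trans (ψ.map_res _).symm)
    | tr w hw => exact (φ.map_tr _).trans ((congrArg S.tr hw).trans (ψ.map_tr _).symm)
    | nm w hw => exact (φ.map_nm _).trans ((congrArg S.nm hw).trans (ψ.map_nm _).symm)
  refine Hom.ext (RingHom.ext fun x => ?_) (RingHom.ext fun x => ?_)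
  · exact Quotient.ind (motive := fun x => φ.bot x = ψ.bot x) (key Level.bot) x
  · exact Quotient.ind (motive := fun x => φ.top x = ψ.top x) (key Level.top) x

/-! ### The universal property of coinduction -/

/-- The function on `C_p` that is `1` at the neutral element and `0` elsewhere. -/
def coindDelta (p : ℕ) [Fact p.Prime] (A : Type u) [CommRing A] : (coind p A).bot :=
  (Pi.single 1 1 : Cp p → A)

/-- An element of the level `C_p/e` whose translates form a complete system of orthogonal
idempotents, and whose transfer is `1`. -/
structure IsFreeIdempotent (S : CpTambara.{u} p) (e : S.bot) : Prop where
  sum_smul : ∑ g : Cp p, g • e = 1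
  mul_smul : ∀ g : Cp p, g ≠ 1 → e * g • e = 0
  tr_eq : S.tr e = 1

theorem coind_smul_apply {A : Type u} [CommRing A] (g h : Cp p) (F : (coind p A).bot) :
    (g • F : (coind p A).bot) h = F (h * g) := rfl

theorem coindDelta_smul_apply {A : Type u} [CommRing A] (g h : Cp p) :
    (g • coindDelta p A : (coind p A).bot) h = if h * g = 1 then 1 else 0 := by
  rw [coind_smul_apply, coindDelta, Pi.single_apply]

theorem coindDelta_apply {A : Type u} [CommRing A] (h : Cp p) :
    (coindDelta p A : (coind p A).bot) h = if h = 1 then 1 else 0 := by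
  rw [coindDelta, Pi.single_apply]

theorem isFreeIdempotent_coindDelta (A : Type u) [CommRing A] :
    IsFreeIdempotent (coind p A) (coindDelta p A) where
  sum_smul := by
    funext h
    refine (Finset.sum_apply (M := fun _ : Cp p => A) h _ _).trans ?_
    simp only [coindDelta_smul_apply, mul_eq_one_iff_eq_inv']
    simp
    rfl
  mul_smul g hg := by
    funext h
    change (coindDelta p A : (coind p A).bot) h * (g • coindDelta p A : (coind p A).bot) h = 0
    rw [coindDelta_smul_apply, coindDelta_apply]
    by_cases h1 : h = 1
    · subst h1
      simp [hg]
    · simp [h1]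
  tr_eq := by
    change ∑ h, (coindDelta p A : (coind p A).bot) h = (1 : A)
    simp [coindDelta_apply]

/-- The conditions are equations between Tambara operations, which morphisms preserve. -/
theorem IsFreeIdempotent.map {S S' : CpTambara.{u} p} {e : S.bot} (he : IsFreeIdempotent S e)
    (f : Hom S S') : IsFreeIdempotent S' (f.bot e) where
  sum_smul := by simp only [← f.map_smul, ← map_sum, he.sum_smul, map_one]
  mul_smul g hg := by rw [← f.map_smul, ← map_mul, he.mul_smul g hg, map_zero]
  tr_eq := by rw [← f.map_tr, he.tr_eq, map_one]

namespace IsFreeIdempotent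

variable {G S : CpTambara.{u} p} {e : S.bot} (he : IsFreeIdempotent S e)

include he

theorem smul_mul_smul {g h : Cp p} (hgh : g ≠ h) : g • e * h • e = 0 := by
  have h1 : g • (e * (g⁻¹ * h) • e) = 0 := by
    rw [he.mul_smul _ (by rwa [Ne, inv_mul_eq_one]), smul_zero]
  rwa [smul_mul', SemigroupAction.mul_smul, smul_inv_smul] at h1

theorem mul_self : e * e = e := by
  have h1 : e * ∑ g : Cp p, g • e = e * e := by
    rw [Finset.mul_sum, Finset.sum_eq_single 1, one_smul]
    · exact fun g _ hg => he.mul_smul g hg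
    · simp
  rw [← h1, he.sum_smul, mul_one]

theorem tr_mul_res (x : S.top) : S.tr (e * S.res x) = x := by
  rw [S.tr_mul_res, he.tr_eq, one_mul]

/-- Orthogonality: multiplying by one translate of `e` isolates the coefficient there, so translates
of `e` serve as coordinates on `S.bot`. -/
theorem mul_sum_smul (a : Cp p → S.bot) (g : Cp p) :
    (∑ h, a h * h • e) * g • e = a g * g • e := by
  rw [Finset.sum_mul, Finset.sum_eq_single g]
  · rw [mul_assoc, ← smul_mul', he.mul_self]
  · intro h _ hg
    rw [mul_assoc, he.smul_mul_smul hg, mul_zero]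
  · simp

/-- The restriction of a transfer is the sum of all translates, and `e` kills all but one of them.
Together with `tr_mul_res`, this makes `a ↦ S.tr (a * e)` and `x ↦ e * S.res x` inverse to each
other between `e * S.bot` and `S.top`. -/
theorem mul_res_tr (a : S.bot) : e * S.res (S.tr (a * e)) = e * a := by
  have h := he.mul_sum_smul (fun h => h • a) 1
  simp only [one_smul] at h
  simp only [S.res_tr, smul_mul']
  rw [mul_comm, h, mul_comm]

theorem tr_ext {x y : S.top} (h : e * S.res x = e * S.res y) : x = y := by
  rw [← he.tr_mul_res x, h, he.tr_mul_res]

omit he in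
theorem mul_prod_congr {A ι : Type*} [CommRing A] {e : A} (s : Finset ι) {a b : ι → A}
    (h : ∀ i, e * a i = e * b i) : e * ∏ i ∈ s, a i = e * ∏ i ∈ s, b i := by
  classical
  induction s using Finset.induction_on with
  | empty => simp
  | insert i s hi ih =>
    rw [Finset.prod_insert hi, Finset.prod_insert hi, mul_left_comm, ih, mul_left_comm,
      ← mul_assoc, h, mul_assoc]

/-- The morphism out of a coinduction that extends a given morphism along `coindUnit` and maps
`coindDelta` to `e`. -/
def coindLift (f : Hom G S) : Hom (coind p G.bot) S where
  bot := {
    toFun := fun F => ∑ h : Cp p, (h⁻¹ • f.bot (F h)) * h⁻¹ • e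
    map_one' := by
      refine Eq.trans (Finset.sum_congr rfl fun h _ => ?_)
        ((Equiv.sum_comp (Equiv.inv (Cp p)) fun h => h • e).trans he.sum_smul)
      change (h⁻¹ • f.bot 1) * h⁻¹ • e = h⁻¹ • e
      rw [map_one, smul_one, one_mul]
    map_mul' := fun F F' => by
      rw [Finset.mul_sum]
      refine Finset.sum_congr rfl fun h _ => ?_
      have h1 := he.mul_sum_smul (fun h => h • f.bot (F h⁻¹)) h⁻¹
      rw [← Equiv.sum_comp (Equiv.inv (Cp p))] at h1
      simp only [Equiv.inv_apply, inv_inv] at h1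
      rw [mul_left_comm, h1]
      change (h⁻¹ • f.bot (F h * F' h)) * h⁻¹ • e = _
      rw [map_mul, smul_mul', mul_assoc, mul_left_comm]
    map_zero' := Finset.sum_eq_zero fun h _ => by
      change (h⁻¹ • f.bot 0) * h⁻¹ • e = 0
      rw [map_zero, smul_zero, zero_mul]
    map_add' := fun F F' => by
      rw [← Finset.sum_add_distrib]
      refine Finset.sum_congr rfl fun h _ => ?_
      change (h⁻¹ • f.bot (F h + F' h)) * h⁻¹ • e = _
      rw [map_add, smul_add, add_mul] }
  top := {
    toFun := fun a => S.tr (f.bot a * e)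
    map_one' := by
      change S.tr (f.bot 1 * e) = 1
      rw [map_one, one_mul, he.tr_eq]
    map_mul' := fun (a b : G.bot) => by
      change S.tr (f.bot (a * b) * e) = S.tr (f.bot a * e) * S.tr (f.bot b * e)
      -- Frobenius reciprocity moves the second transfer inside the first, where the factor `e`
      -- reduces its restriction to `f.bot b`.
      rw [← S.tr_mul_res, mul_assoc, he.mul_res_tr, f.bot.map_mul, mul_assoc, mul_comm e]
    map_zero' := by
      change S.tr (f.bot 0 * e) = 0
      rw [map_zero, zero_mul, map_zero]
    map_add' := fun (a b : G.bot) => by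
      change S.tr (f.bot (a + b) * e) = S.tr (f.bot a * e) + S.tr (f.bot b * e)
      rw [map_add, add_mul, map_add] }
  map_smul g F := by
    change ∑ h : Cp p, (h⁻¹ • f.bot (F (h * g))) * h⁻¹ • e =
      g • ∑ h : Cp p, (h⁻¹ • f.bot (F h)) * h⁻¹ • e
    rw [Finset.smul_sum]
    refine Eq.trans ?_ (Equiv.sum_comp (Equiv.mulRight g)
      fun h => g • ((h⁻¹ • f.bot (F h)) * h⁻¹ • e))
    refine Finset.sum_congr rfl fun h _ => ?_
    simp only [Equiv.coe_mulRight, mul_inv_rev, smul_mul', SemigroupAction.mul_smul, smul_inv_smul]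
  map_res a := by
    change ∑ h : Cp p, (h⁻¹ • f.bot a) * h⁻¹ • e = S.res (S.tr (f.bot a * e))
    rw [S.res_tr, ← Equiv.sum_comp (Equiv.inv (Cp p))]
    simp only [Equiv.inv_apply, inv_inv, smul_mul']
  map_tr F := by
    change S.tr (f.bot (∑ h, F h) * e) = S.tr (∑ h : Cp p, (h⁻¹ • f.bot (F h)) * h⁻¹ • e)
    rw [map_sum f.bot F, Finset.sum_mul, map_sum, map_sum]
    simp only [← smul_mul', S.tr_smul]
  map_nm F := by
    -- Equality on level `C_p/C_p` can be tested on level `C_p/e` after multiplying by `e`. There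
    -- the norm becomes a product of translates, and the factors can be compared one at a time:
    -- modulo `e`, the translate by `g` retains only the value of `F` at `g`.
    refine he.tr_ext ?_
    change e * S.res (S.tr (f.bot (∏ h, F h) * e)) =
      e * S.res (S.nm (∑ h : Cp p, (h⁻¹ • f.bot (F h)) * h⁻¹ • e))
    rw [he.mul_res_tr, S.res_nm, map_prod f.bot F]
    refine mul_prod_congr _ fun g => ?_
    have h1 := he.mul_sum_smul (fun h => (h • f.bot (F h⁻¹))) g⁻¹
    rw [← Equiv.sum_comp (Equiv.inv (Cp p))] at h1
    simp only [Equiv.inv_apply, inv_inv] at h1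
    have h2 := congrArg (g • ·) h1
    simp only [smul_mul' g _ (g⁻¹ • e), smul_inv_smul] at h2
    exact (mul_comm _ _).trans (h2.symm.trans (mul_comm _ _))

theorem coindLift_comp_coindUnit (f : Hom G S) : (he.coindLift f).comp (coindUnit G) = f := by
  refine Hom.ext (RingHom.ext fun a => ?_) (RingHom.ext fun x => ?_)
  · change ∑ h : Cp p, (h⁻¹ • f.bot (h • a)) * h⁻¹ • e = f.bot a
    simp only [f.map_smul, inv_smul_smul]
    have h1 : ∑ h : Cp p, h⁻¹ • e = 1 :=
      (Equiv.sum_comp (Equiv.inv (Cp p)) fun h => h • e).trans he.sum_smul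
    rw [← Finset.mul_sum, h1, mul_one]
  · change S.tr (f.bot (G.res x) * e) = f.top x
    rw [f.map_res, mul_comm, he.tr_mul_res]

theorem coindLift_coindDelta (f : Hom G S) :
    (he.coindLift f).bot (coindDelta p G.bot) = e := by
  change ∑ h : Cp p, (h⁻¹ • f.bot ((coindDelta p G.bot : (coind p G.bot).bot) h)) * h⁻¹ • e = e
  rw [Finset.sum_eq_single 1]
  · rw [coindDelta_apply, if_pos rfl, map_one, smul_one, one_mul, inv_one, one_smul]
  · intro h _ hh
    rw [coindDelta_apply, if_neg hh, map_zero, smul_zero, zero_mul]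
  · simp

end IsFreeIdempotent

variable {G S : CpTambara.{u} p}

/-- The translate by `h⁻¹` of `coindDelta` is the indicator of `h`, so this splits a function into
its values. With `coind_top_eq` it shows that `coindDelta` generates the coinduction over `G`. -/
theorem coind_bot_eq (F : (coind p G.bot).bot) :
    F = ∑ h : Cp p, h⁻¹ • ((coindUnit G).bot (F h) * coindDelta p G.bot) := by
  funext k
  refine Eq.trans ?_ (Finset.sum_apply (M := fun _ : Cp p => G.bot) k _ _).symm
  rw [Finset.sum_eq_single k]
  · rw [coind_smul_apply]
    change F k = (k * k⁻¹) • F k * (coindDelta p G.bot : (coind p G.bot).bot) (k * k⁻¹)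
    rw [mul_inv_cancel, one_smul, coindDelta_apply, if_pos rfl, mul_one]
  · intro h _ hh
    rw [coind_smul_apply]
    change _ * (coindDelta p G.bot : (coind p G.bot).bot) (k * h⁻¹) = 0
    rw [coindDelta_apply, if_neg (by rw [mul_inv_eq_one]; exact hh.symm), mul_zero]
  · simp

theorem coind_top_eq (a : G.bot) :
    (show (coind p G.bot).top from a) = (coind p G.bot).tr ((coindUnit G).bot a * coindDelta p G.bot) := by
  change a = ∑ h : Cp p, h • a * (coindDelta p G.bot : (coind p G.bot).bot) h
  rw [Finset.sum_eq_single 1]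
  · rw [coindDelta_apply, if_pos rfl, one_smul]
    exact (mul_one (M := G.bot) a).symm
  · intro h _ hh
    rw [coindDelta_apply, if_neg hh, mul_zero]
  · simp

/-- Morphisms out of a coinduction agree if they agree on the image of `coindUnit` and on
`coindDelta`. -/
theorem coind_hom_ext {φ ψ : Hom (coind p G.bot) S}
    (h : φ.comp (coindUnit G) = ψ.comp (coindUnit G))
    (hd : φ.bot (coindDelta p G.bot) = ψ.bot (coindDelta p G.bot)) : φ = ψ := by
  have hb : ∀ a, φ.bot ((coindUnit G).bot a * coindDelta p G.bot) =
      ψ.bot ((coindUnit G).bot a * coindDelta p G.bot) := fun a => by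
    rw [map_mul, map_mul, hd]
    exact congrArg (· * _) (RingHom.congr_fun (congrArg Hom.bot h) a)
  refine Hom.ext (RingHom.ext fun F => ?_) (RingHom.ext fun a => ?_)
  · rw [coind_bot_eq F]
    simp only [map_sum, φ.map_smul, ψ.map_smul, hb]
  · refine ((congrArg φ.top (coind_top_eq a)).trans ?_).trans (congrArg ψ.top (coind_top_eq a)).symm
    exact (φ.map_tr _).trans ((congrArg S.tr (hb a)).trans (ψ.map_tr _).symm)

/-! ### Coinduction is finitely presented and unramified -/

theorem coindUnit_finitelyPresented (G : CpTambara.{u} p) : (coindUnit G).FinitelyPresented := by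
  classical
  let δ := coindDelta p G.bot
  have hδ : IsFreeIdempotent _ δ := isFreeIdempotent_coindDelta G.bot
  let C := polyC G 1 0
  let x : (poly G 1 0).bot := Presented.mk _ (Word.genBot (Sum.inr 0))
  let π : Hom (poly G 1 0) (coind p G.bot) :=
    presentedLift (β := Sum.elim (coindUnit G).bot fun _ => δ)
      (τ := Sum.elim (coindUnit G).top Fin.elim0) ⟨coindUnit G, fun _ => rfl, fun _ => rfl⟩
  have hπx : π.bot x = δ := rfl
  have hπC : π.comp C = coindUnit G := rfl
  have hb : ∀ a, π.bot (C.bot a) = (coindUnit G).bot a := fun _ => rfl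
  -- The relations imposed on the generator `x`, in `s` and `t`, are exactly those that make it an
  -- `IsFreeIdempotent`.
  let s : Finset (poly G 1 0).bot :=
    insert (∑ g : Cp p, g • x - 1)
      ((Finset.univ.filter fun g : Cp p => g ≠ 1).image fun g => x * g • x)
  let t : Finset (poly G 1 0).top := {(poly G 1 0).tr x - 1}
  let J : TIdeal (poly G 1 0) := TIdeal.span (s : Set (poly G 1 0).bot) (t : Set (poly G 1 0).top)
  have hx : IsFreeIdempotent J.quotient (J.quotientMk.bot x) := by
    constructor
    · simp only [← J.quotientMk.map_smul]
      rw [← map_sum, ← sub_eq_zero, ← map_one J.quotientMk.bot, ← map_sub,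
        TIdeal.quotientMk_bot_eq_zero]
      exact TIdeal.subset_span_bot (Finset.mem_coe.2 (Finset.mem_insert_self _ _))
    · intro g hg
      rw [← J.quotientMk.map_smul, ← map_mul, TIdeal.quotientMk_bot_eq_zero]
      exact TIdeal.subset_span_bot (Finset.mem_coe.2 (Finset.mem_insert_of_mem
        (Finset.mem_image_of_mem _ (Finset.mem_filter.2 ⟨Finset.mem_univ _, hg⟩))))
    · rw [← J.quotientMk.map_tr, ← sub_eq_zero, ← map_one J.quotientMk.top, ← map_sub,
        TIdeal.quotientMk_top_eq_zero]
      exact TIdeal.subset_span_top (Finset.mem_coe.2 (Finset.mem_singleton_self _))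
  refine ⟨1, 0, π, hπC, ?_, ?_, s, t, ?_⟩
  · intro F
    refine ⟨∑ h : Cp p, h⁻¹ • (C.bot (F h) * x), ?_⟩
    simp only [map_sum, π.map_smul, map_mul, hπx, hb]
    exact (coind_bot_eq F).symm
  · intro a
    refine ⟨(poly G 1 0).tr (C.bot a * x), ?_⟩
    exact (π.map_tr _).trans (coind_top_eq a).symm
  · refine TIdeal.le_antisymm (TIdeal.ker_le_of_comp_eq (k := hx.coindLift (J.quotientMk.comp C))
      (presented_hom_ext ?_ ?_)) (TIdeal.span_le.2 ⟨?_, ?_⟩)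
    · rintro (a | i)
      · exact RingHom.congr_fun
          (congrArg Hom.bot (hx.coindLift_comp_coindUnit (J.quotientMk.comp C))) a
      · obtain rfl : i = 0 := Subsingleton.elim _ _
        exact hx.coindLift_coindDelta (J.quotientMk.comp C)
    · rintro (a | i)
      · exact RingHom.congr_fun
          (congrArg Hom.top (hx.coindLift_comp_coindUnit (J.quotientMk.comp C))) a
      · exact i.elim0
    · intro y hy
      rcases Finset.mem_insert.1 (Finset.mem_coe.1 hy) with rfl | hy
      · change π.bot _ = 0
        simp only [map_sub, map_sum, π.map_smul, hπx, map_one]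
        rw [hδ.sum_smul, sub_self]
      · obtain ⟨g, hg, rfl⟩ := Finset.mem_image.1 hy
        change π.bot _ = 0
        rw [map_mul, π.map_smul, hπx, hδ.mul_smul g (Finset.mem_filter.1 hg).2]
    · intro y hy
      obtain rfl := Finset.mem_singleton.1 (Finset.mem_coe.1 hy)
      change π.top _ = 0
      rw [map_sub, π.map_tr, hπx, map_one, hδ.tr_eq, sub_self]

/-! ### Coprojections of the box square and vanishing of the Kähler differentials -/

section boxSelf

variable {R S : CpTambara.{u} p} (f : Hom R S)

/-- The first coprojection `S → S □_R S`. -/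
def boxSelfInl : Hom S (boxSelf f) :=
  presentedOf Sum.inl Sum.inl fun Q β τ k => by
    obtain ⟨φ, ψ, -, rfl, rfl⟩ := k
    exact ⟨φ, fun _ => rfl, fun _ => rfl⟩

/-- The second coprojection `S → S □_R S`. -/
def boxSelfInr : Hom S (boxSelf f) :=
  presentedOf Sum.inr Sum.inr fun Q β τ k => by
    obtain ⟨φ, ψ, -, rfl, rfl⟩ := k
    exact ⟨ψ, fun _ => rfl, fun _ => rfl⟩

theorem boxSelfInl_comp : (boxSelfInl f).comp f = (boxSelfInr f).comp f := by
  refine Hom.ext (RingHom.ext fun a => Quotient.sound ?_) (RingHom.ext fun x => Quotient.sound ?_)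
  · rintro Q β τ ⟨φ, ψ, h, rfl, rfl⟩
    exact RingHom.congr_fun (congrArg Hom.bot h) a
  · rintro Q β τ ⟨φ, ψ, h, rfl, rfl⟩
    exact RingHom.congr_fun (congrArg Hom.top h) x

/-- If the two coprojections agree modulo `J`, then `J` contains the kernel of the
multiplication. -/
theorem ker_boxSelfMul_le {J : TIdeal (boxSelf f)}
    (h : J.quotientMk.comp (boxSelfInl f) = J.quotientMk.comp (boxSelfInr f)) :
    (boxSelfMul f).ker ≤ J := by
  refine TIdeal.ker_le_of_comp_eq (k := J.quotientMk.comp (boxSelfInl f))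
    (presented_hom_ext ?_ ?_)
  · rintro (a | a)
    · rfl
    · exact RingHom.congr_fun (congrArg Hom.bot h) a
  · rintro (a | a)
    · rfl
    · exact RingHom.congr_fun (congrArg Hom.top h) a

end boxSelf

/-- A map out of the coinduction is determined over `G` by the image of `coindDelta`. So it suffices
that the two copies of this element differ by a decomposable. -/
theorem ker_boxSelfMul_coindUnit_le (G : CpTambara.{u} p) :
    (boxSelfMul (coindUnit G)).ker ≤ (boxSelfMul (coindUnit G)).ker.decomposables := by
  let f := coindUnit G
  let I := (boxSelfMul f).ker
  let e := (boxSelfInl f).bot (coindDelta p G.bot)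
  let e' := (boxSelfInr f).bot (coindDelta p G.bot)
  have he : e * e = e := ((isFreeIdempotent_coindDelta G.bot).map (boxSelfInl f)).mul_self
  have he' : e' * e' = e' := ((isFreeIdempotent_coindDelta G.bot).map (boxSelfInr f)).mul_self
  have hmem : e - e' ∈ I.bot := by
    change (boxSelfMul f).bot (e - e') = 0
    rw [map_sub, sub_eq_zero]
    rfl
  -- The difference of two commuting idempotents equals its cube.
  have hd : e - e' = (e - e') * ((e - e') * (e - e')) := by
    linear_combination (e + 1 - 3 * e') * he.symm - (e' + 1 - 3 * e) * he'.symm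
  have hdec : e - e' ∈ I.decomposables.bot := by
    rw [hd]
    exact TIdeal.subset_span_bot ⟨_, hmem, _, I.bot.mul_mem_left _ hmem, rfl⟩
  refine ker_boxSelfMul_le f (coind_hom_ext ?_ ?_)
  · exact congrArg (Hom.comp I.decomposables.quotientMk) (boxSelfInl_comp f)
  · exact sub_eq_zero.1 ((map_sub I.decomposables.quotientMk.bot e e').symm.trans
      (TIdeal.quotientMk_bot_eq_zero.2 hdec))

theorem subsingleton_kaehlerBot_coindUnit (G : CpTambara.{u} p) :
    Subsingleton (kaehlerBot (coindUnit G)) :=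
  Submodule.Quotient.subsingleton_iff.2 <| eq_top_iff.2 fun x _ =>
    (ker_boxSelfMul_coindUnit_le G).1 x.2

theorem subsingleton_kaehlerTop_coindUnit (G : CpTambara.{u} p) :
    Subsingleton (kaehlerTop (coindUnit G)) :=
  Submodule.Quotient.subsingleton_iff.2 <| eq_top_iff.2 fun x _ =>
    (ker_boxSelfMul_coindUnit_le G).2 x.2

/-! ### Coinduction is flat -/

section Flat

variable (G : CpTambara.{u} p)

/-- The scalar `a` acts on the value at `h` through `h • a`. Translating that value by `h⁻¹` removes
the twist and leaves a finite free module. -/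
theorem coindUnit_flat_bot : Module.Flat G.bot (coindUnit G).toMod.bot := by
  let e : (coindUnit G).toMod.bot ≃ₗ[G.bot] (Cp p → G.bot) :=
    { toFun := fun F h => h⁻¹ • (show G.bot from F h)
      invFun := fun F => (fun h => h • F h : Cp p → G.bot)
      map_add' := fun F F' => funext fun h => smul_add h⁻¹ (F h : G.bot) (F' h)
      map_smul' := fun a F => funext fun h => by
        change h⁻¹ • (h • a * F h : G.bot) = a * h⁻¹ • (F h : G.bot)
        rw [smul_mul', inv_smul_smul]
      left_inv := fun F => funext fun h => smul_inv_smul h (F h : G.bot)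
      right_inv := fun F => funext fun h => inv_smul_smul h (F h) }
  exact Module.Flat.of_linearEquiv e

variable {G}

/-- The map from a module to the level `C_p/C_p` of its box product with a coinduction. -/
def toBoxTop (M : Mod G) : M.bot →+ Mod.boxTop M (coindUnit G).toMod :=
  (QuotientAddGroup.mk' _).comp <| (AddMonoidHom.inr _ _).comp
    ((TensorProduct.mk G.bot M.bot (coindUnit G).toMod.bot).flip
      (show (coindUnit G).toMod.bot from coindDelta p G.bot)).toAddMonoidHom

theorem toBoxTop_apply (M : Mod G) (m : M.bot) : toBoxTop M m =
    QuotientAddGroup.mk' (Mod.boxRel M (coindUnit G).toMod)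
      (0, m ⊗ₜ[G.bot] (show (coindUnit G).toMod.bot from coindDelta p G.bot)) := rfl

theorem boxMapTop_toBoxTop {M M' : Mod G} (f : Mod.Hom M M') (m : M.bot) :
    Mod.boxMapTop f (coindUnit G).toMod (toBoxTop M m) = toBoxTop M' (f.bot m) := by
  rw [toBoxTop_apply, toBoxTop_apply]
  exact congrArg (QuotientAddGroup.mk' (Mod.boxRel M' (coindUnit G).toMod))
    (Prod.ext (map_zero (LinearMap.rTensor (coindUnit G).toMod.top f.top)) rfl)

/-- The map from the tensor product on the level `C_p/C_p` to a module. -/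
def ofTensorTop (M : Mod G) : M.top ⊗[G.top] (coindUnit G).toMod.top →+ M.bot :=
  TensorProduct.liftAddHom
    (AddMonoidHom.mk' (fun y => AddMonoidHom.mk' (fun a : G.bot => a • M.res y)
      fun a b => add_smul (R := G.bot) a b _) fun y z => by
        refine AddMonoidHom.ext fun a : G.bot => ?_
        exact (congrArg (a • ·) (map_add M.res y z)).trans (smul_add a _ _))
    fun x y (a : G.bot) => by
      change a • M.res (x • y) = (G.res x * a) • M.res y
      rw [M.res_smul, smul_smul, mul_comm]

/-- The map from the tensor product on the level `C_p/e` to a module. -/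
def ofTensorBot (M : Mod G) : M.bot ⊗[G.bot] (coindUnit G).toMod.bot →+ M.bot :=
  TensorProduct.liftAddHom
    (AddMonoidHom.mk' (fun m => AddMonoidHom.mk'
      (fun F : Cp p → G.bot => ∑ h : Cp p, F h • h • m) fun F F' =>
        (Finset.sum_congr rfl fun h _ => add_smul (F h : G.bot) (F' h) (h • m)).trans
          Finset.sum_add_distrib) fun m m' => by
        ext F
        change ∑ h : Cp p, (_ : G.bot) • h • (m + m') = _
        simp only [smul_add, Finset.sum_add_distrib]
        rfl)
    fun a m (F : Cp p → G.bot) => by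
      change ∑ h : Cp p, F h • h • (a • m) = ∑ h : Cp p, (h • a * F h) • h • m
      refine Finset.sum_congr rfl fun h _ => ?_
      rw [M.weyl_smul, smul_smul, mul_comm]

/-- The map from the level `C_p/C_p` of the box product of a module and a coinduction to the
module. -/
def ofBoxTop (M : Mod G) : Mod.boxTop M (coindUnit G).toMod →+ M.bot :=
  QuotientAddGroup.lift _ ((ofTensorTop M).coprod (ofTensorBot M)) <| by
    rw [Mod.boxRel, AddSubgroup.closure_le]
    -- The three families of relations hold in `M.bot` because, respectively, restrictions are
    -- Weyl-invariant, the restriction of a transfer is the sum of the translates, and the sum over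
    -- `C_p` can be reindexed by a translation.
    rintro _ ((⟨y, F, rfl⟩ | ⟨m, a, rfl⟩) | ⟨g, m, F, rfl⟩)
    · refine AddMonoidHom.mem_ker.2 ((AddMonoidHom.coprod_apply _ _ _).trans ?_)
      rw [map_neg, ← sub_eq_add_neg, sub_eq_zero]
      change (∑ h, (F h : G.bot)) • M.res y = ∑ h : Cp p, (F h : G.bot) • h • M.res y
      simp only [M.weyl_res]
      exact Finset.sum_smul
    · refine AddMonoidHom.mem_ker.2 ((AddMonoidHom.coprod_apply _ _ _).trans ?_)
      rw [map_neg, ← sub_eq_add_neg, sub_eq_zero]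
      change (show G.bot from a) • M.res (M.tr m) = ∑ h : Cp p, (show G.bot from a) • h • m
      rw [M.res_tr]
      exact Finset.smul_sum
    · refine AddMonoidHom.mem_ker.2 ((AddMonoidHom.coprod_apply _ _ _).trans ?_)
      rw [map_zero, zero_add, map_sub, sub_eq_zero]
      change ∑ h : Cp p, (F (h * g) : G.bot) • h • g • m = ∑ h : Cp p, (F h : G.bot) • h • m
      simp only [← mul_smul]
      exact Equiv.sum_comp (Equiv.mulRight g) fun h => (F h : G.bot) • h • m

theorem ofBoxTop_toBoxTop (M : Mod G) (m : M.bot) : ofBoxTop M (toBoxTop M m) = m := by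
  change ofTensorTop M 0 +
    ∑ h : Cp p, (coindDelta p G.bot : (coind p G.bot).bot) h • h • m = m
  rw [map_zero, zero_add, Finset.sum_eq_single 1]
  · rw [coindDelta_apply, if_pos rfl]
    exact (one_smul G.bot _).trans (one_smul (Cp p) m)
  · intro h _ hh
    rw [coindDelta_apply, if_neg hh]
    exact zero_smul G.bot _
  · simp

theorem mk_tmul_smul (M : Mod G) (N : Mod G) (g : Cp p) (m : M.bot) (n : N.bot) :
    QuotientAddGroup.mk' (Mod.boxRel M N) (0, m ⊗ₜ (g • n)) =
      QuotientAddGroup.mk' (Mod.boxRel M N) (0, (g⁻¹ • m) ⊗ₜ n) := by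
  rw [← sub_eq_zero, ← map_sub, Prod.mk_sub_mk, sub_zero]
  refine (QuotientAddGroup.eq_zero_iff _).2
    (AddSubgroup.subset_closure (Or.inr ⟨g, g⁻¹ • m, n, ?_⟩))
  rw [smul_inv_smul]

theorem mk_tmul_tr (M : Mod G) (N : Mod G) (y : M.top) (n : N.bot) :
    QuotientAddGroup.mk' (Mod.boxRel M N) (y ⊗ₜ N.tr n, 0) =
      QuotientAddGroup.mk' (Mod.boxRel M N) (0, M.res y ⊗ₜ n) := by
  rw [← sub_eq_zero, ← map_sub, Prod.mk_sub_mk, sub_zero, zero_sub]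
  exact (QuotientAddGroup.eq_zero_iff _).2
    (AddSubgroup.subset_closure (Or.inl (Or.inl ⟨y, n, rfl⟩)))

/-- Write `F` as a sum of translates of multiples of `coindDelta`. Invariance of the transfer
carries each translation over to `m`, and the coefficient crosses the tensor sign. -/
theorem toBoxTop_tmul_bot (M : Mod G) (m : M.bot) (F : (coindUnit G).toMod.bot) :
    QuotientAddGroup.mk' (Mod.boxRel M (coindUnit G).toMod) (0, m ⊗ₜ F) =
      toBoxTop M (ofTensorBot M (m ⊗ₜ F)) := by
  let N := (coindUnit G).toMod
  let δ : N.bot := coindDelta p G.bot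
  let q : M.bot ⊗[G.bot] N.bot →+ Mod.boxTop M N :=
    (QuotientAddGroup.mk' (Mod.boxRel M N)).comp (AddMonoidHom.inr _ _)
  have hF : F = ∑ h : Cp p, h⁻¹ • ((F h : G.bot) • δ) := coind_bot_eq F
  change q (m ⊗ₜ F) = toBoxTop M (∑ h : Cp p, (F h : G.bot) • h • m)
  rw [map_sum]
  refine (congrArg (fun X => q (m ⊗ₜ X)) hF).trans ?_
  rw [TensorProduct.tmul_sum, map_sum]
  refine Finset.sum_congr rfl fun h _ => ?_
  refine (mk_tmul_smul M N h⁻¹ m _).trans ?_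
  rw [inv_inv, ← TensorProduct.smul_tmul]
  rfl

/-- Every `a` is the transfer of a multiple of `coindDelta`, so Frobenius reciprocity turns the
tensor into a transfer from level `C_p/e`. -/
theorem toBoxTop_tmul_top (M : Mod G) (y : M.top) (a : (coindUnit G).toMod.top) :
    QuotientAddGroup.mk' (Mod.boxRel M (coindUnit G).toMod) (y ⊗ₜ a, 0) =
      toBoxTop M (ofTensorTop M (y ⊗ₜ a)) := by
  let N := (coindUnit G).toMod
  let δ : N.bot := coindDelta p G.bot
  have ha : a = N.tr ((show G.bot from a) • δ) := coind_top_eq (G := G) a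
  refine (congrArg (fun b => QuotientAddGroup.mk' (Mod.boxRel M N) (y ⊗ₜ[G.top] b, 0)) ha).trans ?_
  rw [mk_tmul_tr, ← TensorProduct.smul_tmul]
  rfl

theorem toBoxTop_ofBoxTop (M : Mod G) (z : Mod.boxTop M (coindUnit G).toMod) :
    toBoxTop M (ofBoxTop M z) = z := by
  obtain ⟨⟨s, t⟩, rfl⟩ := QuotientAddGroup.mk'_surjective _ z
  change toBoxTop M (ofTensorTop M s + ofTensorBot M t) = _
  have hs : toBoxTop M (ofTensorTop M s) =
      QuotientAddGroup.mk' (Mod.boxRel M (coindUnit G).toMod) (s, 0) := by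
    induction s using TensorProduct.induction_on with
    | zero => simp only [map_zero]; rfl
    | tmul y a => exact (toBoxTop_tmul_top M y a).symm
    | add s s' h h' =>
      rw [map_add, map_add, h, h', ← map_add, Prod.mk_add_mk, add_zero]
  have ht : toBoxTop M (ofTensorBot M t) =
      QuotientAddGroup.mk' (Mod.boxRel M (coindUnit G).toMod) (0, t) := by
    induction t using TensorProduct.induction_on with
    | zero => simp only [map_zero]; rfl
    | tmul m F => exact (toBoxTop_tmul_bot M m F).symm
    | add s s' h h' =>
      rw [map_add, map_add, h, h', ← map_add, Prod.mk_add_mk, add_zero]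
  rw [map_add, hs, ht, ← map_add, Prod.mk_add_mk, add_zero, zero_add]

/-- The level `C_p/C_p` of the box product of a module `M` and a coinduction is the level `C_p/e`
of `M`. -/
def boxTopEquiv (M : Mod G) : M.bot ≃+ Mod.boxTop M (coindUnit G).toMod where
  toFun := toBoxTop M
  invFun := ofBoxTop M
  left_inv := ofBoxTop_toBoxTop M
  right_inv := toBoxTop_ofBoxTop M
  map_add' := map_add _

variable (G) in
theorem coindUnit_flat : (coindUnit G).toMod.Flat := by
  intro M M' M'' f g hb ht
  have := coindUnit_flat_bot G
  refine ⟨Module.Flat.rTensor_exact _ hb, ?_⟩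
  -- By naturality of `boxTopEquiv`, the boxed sequence on level `C_p/C_p` is the original sequence
  -- on level `C_p/e`.
  exact Function.Exact.of_ladder_addEquiv_of_exact (e₁ := boxTopEquiv M) (e₂ := boxTopEquiv M')
    (e₃ := boxTopEquiv M'') (f₁₂ := f.bot.toAddMonoidHom) (f₂₃ := g.bot.toAddMonoidHom)
    (AddMonoidHom.ext fun m => boxMapTop_toBoxTop f m)
    (AddMonoidHom.ext fun m => boxMapTop_toBoxTop g m) hb

end Flat

/-! ### Nakaoka spectra -/

/-- Open subsets of the Nakaoka spectrum are stable under passage to smaller prime ideals. -/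
theorem Spec.mem_of_isOpen {R : CpTambara.{u} p} {P Q : Spec R} (h : P.1 ≤ Q.1) {U : Set (Spec R)}
    (hU : IsOpen U) (hQ : Q ∈ U) : P ∈ U := by
  induction hU with
  | basic s hs =>
    obtain ⟨I, rfl⟩ := hs
    exact fun hI => hQ ⟨hI.1.trans h.1, hI.2.trans h.2⟩
  | univ => trivial
  | inter s t _ _ ihs iht => exact ⟨ihs hQ.1, iht hQ.2⟩
  | sUnion S _ ih =>
    obtain ⟨s, hs, hQs⟩ := hQ
    exact ⟨s, hs, ih s hs hQs⟩

/-- The Tambara ideal of a coinduction given by an ideal `I`. -/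
def coindIdeal {A : Type u} [CommRing A] (I : Ideal A) : TIdeal (coind p A) where
  bot := Ideal.pi fun _ : Cp p => I
  top := I
  smul_mem g _ h := fun k => h (k * g)
  res_mem h := fun _ => h
  tr_mem h := I.sum_mem fun k _ => h k
  nm_mem h := I.prod_mem (Finset.mem_univ 1) (h 1)

/-- Containment of a Tambara ideal in `coindIdeal I` can be checked on level `C_p/C_p`, where the
claim is primality of `I`. -/
theorem coindIdeal_isPrime {A : Type u} [CommRing A] {I : Ideal A} (hI : I.IsPrime) :
    (coindIdeal (p := p) I).IsPrime where
  ne_top h := hI.ne_top (congrArg TIdeal.top h)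
  le_or_le J K h := by
    have key : ∀ L : TIdeal (coind p A), L.top ≤ I → L ≤ coindIdeal (p := p) I := by
      refine fun L hL => ⟨fun F hF k => hL ?_, hL⟩
      -- Cutting `F` down to the point `k` and transferring puts the single value `F k` in `L.top`.
      have h1 := L.tr_mem (L.bot.mul_mem_left (show (coind p A).bot from (Pi.single k 1 : Cp p → A)) hF)
      have h2 : (coind p A).tr ((show (coind p A).bot from (Pi.single k 1 : Cp p → A)) * F) = F k := by
        change ∑ h, (Pi.single k 1 : Cp p → A) h * F h = F k
        rw [Finset.sum_eq_single k]
        · rw [Pi.single_eq_same]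
          exact one_mul (M := A) (F k)
        · intro h _ hh
          rw [Pi.single_eq_of_ne hh]
          exact zero_mul (M₀ := A) (F h)
        · simp
      rwa [h2] at h1
    rcases hI.mul_le.1 (Ideal.mul_le.2 fun x hx y hy => (TIdeal.mul_le.1 h).2 x hx y hy) with h | h
    · exact Or.inl (key J h)
    · exact Or.inr (key K h)

/-- The ring homomorphism induced by the norm modulo transfers. -/
def geometricNorm (R : CpTambara.{u} p) : R.bot →+* R.top ⧸ R.transferIdeal where
  toFun a := Ideal.Quotient.mk R.transferIdeal (R.nm a)
  map_one' := by rw [map_one, map_one]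
  map_mul' a b := by rw [map_mul, map_mul]
  map_zero' := by rw [R.nm_zero, map_zero]
  map_add' a b := by
    -- The cross terms in the norm of a sum are transfers, so they vanish in the quotient.
    rw [R.nm_add, map_add, map_add, map_sum, add_eq_left]
    exact Finset.sum_eq_zero fun ω _ =>
      Ideal.Quotient.eq_zero_iff_mem.2 (R.tr_mem_transferIdeal _)

theorem geometricNorm_smul (R : CpTambara.{u} p) (g : Cp p) (a : R.bot) :
    R.geometricNorm (g • a) = R.geometricNorm a :=
  congrArg (Ideal.Quotient.mk R.transferIdeal) (R.nm_smul g a)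

/-! ### Primes of the ghost from its second factor, and failure of openness -/

section ghostIdeal

variable {R : CpTambara.{u} p} (q : Ideal (R.top ⧸ R.transferIdeal))

theorem smul_mem_comap_geometricNorm (g : Cp p) {a : R.bot} (h : a ∈ q.comap R.geometricNorm) :
    g • a ∈ q.comap R.geometricNorm := by
  rwa [Ideal.mem_comap, geometricNorm_smul]

/-- The Tambara ideal of the ghost given by an ideal of the second factor of the level
`C_p/C_p`. -/
def ghostIdeal : TIdeal (ghost R) where
  bot := q.comap R.geometricNorm
  top := Ideal.prod ((q.comap R.geometricNorm).comap R.fixedPoints.subtype) q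
  smul_mem g _ h := smul_mem_comap_geometricNorm q g h
  res_mem h := h.1
  tr_mem h := ⟨Ideal.sum_mem (q.comap R.geometricNorm) fun g _ =>
    smul_mem_comap_geometricNorm q g h, q.zero_mem⟩
  nm_mem h := ⟨Ideal.prod_mem (q.comap R.geometricNorm) (Finset.mem_univ 1)
    (smul_mem_comap_geometricNorm q 1 h), h⟩

/-- Containment in `ghostIdeal q` depends only on the second coordinates on level `C_p/C_p`, because
norms carry level `C_p/e` into them. Primality then reduces to that of `q`. -/
theorem ghostIdeal_isPrime (hq : q.IsPrime) : (ghostIdeal q).IsPrime where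
  ne_top h := hq.ne_top <| by
    have h1 : (1 : (ghost R).top) ∈ (ghostIdeal q).top :=
      h ▸ (trivial : (1 : (ghost R).top) ∈ (⊤ : Ideal _))
    exact (Ideal.eq_top_iff_one _).2 h1.2
  le_or_le I J h := by
    obtain ⟨h1, h2⟩ := TIdeal.mul_le.1 h
    have key : ∀ L : TIdeal (ghost R), (∀ x ∈ L.top, x.2 ∈ q) → L ≤ ghostIdeal q := by
      intro L hL
      have hb : L.bot ≤ (ghostIdeal q).bot := fun a ha => hL _ (L.nm_mem ha)
      exact ⟨hb, fun x hx => ⟨hb (L.res_mem hx), hL x hx⟩⟩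
    by_contra hc
    rw [not_or] at hc
    obtain ⟨hI, hJ⟩ := hc
    obtain ⟨x, hx, hxq⟩ : ∃ x ∈ I.top, x.2 ∉ q := by
      by_contra hn
      push Not at hn
      exact hI (key I hn)
    obtain ⟨y, hy, hyq⟩ : ∃ y ∈ J.top, y.2 ∉ q := by
      by_contra hn
      push Not at hn
      exact hJ (key J hn)
    exact (hq.mem_or_mem (h2 x hx y hy).2).elim hxq hyq

end ghostIdeal

theorem not_isOpenMap_spec_ghostToCoind (R : CpTambara.{u} p) (hR : ¬ Function.Surjective R.tr) :
    ¬ IsOpenMap (Spec.map (ghostToCoind R)) := by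
  intro hopen
  have hT : R.transferIdeal ≠ ⊤ := fun h => hR fun x => by
    obtain ⟨a, -, ha⟩ : x ∈ R.transferIdeal := h ▸ trivial
    exact ⟨a, ha⟩
  have : Nontrivial (R.top ⧸ R.transferIdeal) := Ideal.Quotient.nontrivial_iff.2 hT
  obtain ⟨q, hq⟩ := Ideal.exists_maximal (R.top ⧸ R.transferIdeal)
  let P : Spec (ghost R) := ⟨ghostIdeal q, ghostIdeal_isPrime q hq.isPrime⟩
  let Q : Spec (coind p R.bot) := ⟨coindIdeal (q.comap R.geometricNorm),
    coindIdeal_isPrime (hq.isPrime.comap R.geometricNorm)⟩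
  -- Both ideals agree on level `C_p/e` and in the first coordinate above it; only `P` also
  -- constrains the second coordinate.
  have hPQ : P.1 ≤ (Spec.map (ghostToCoind R) Q).1 :=
    ⟨fun a ha k => smul_mem_comap_geometricNorm q k ha, fun x hx => hx.1⟩
  have hP : P ∈ Spec.map (ghostToCoind R) '' Set.univ :=
    Spec.mem_of_isOpen hPQ (hopen _ isOpen_univ) ⟨Q, trivial, rfl⟩
  obtain ⟨Q', -, hQ'⟩ := hP
  -- On level `C_p/C_p` the canonical map is the first projection, so every preimage of an ideal
  -- contains `(0, 1)`, while `P` would contain it only if `1 ∈ q`.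
  have h1 : ((0, 1) : (ghost R).top) ∈ (Spec.map (ghostToCoind R) Q').1.top := by
    change (ghost R).res (0, 1) ∈ Q'.1.top
    exact Q'.1.top.zero_mem
  rw [hQ'] at h1
  exact hq.ne_top ((Ideal.eq_top_iff_one _).2 h1.2)

end CpTambara

/-- Coinduction from the trivial group is étale over every `C_p`-Tambara functor. -/
theorem CpTambara.coindUnit_etale {p : ℕ} [Fact p.Prime] (G : CpTambara.{u} p) :
    (coindUnit G).Etale where
  finitelyPresented := coindUnit_finitelyPresented G
  flat := coindUnit_flat G
  kaehlerBot := subsingleton_kaehlerBot_coindUnit G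
  kaehlerTop := subsingleton_kaehlerTop_coindUnit G

theorem mainTheorem3 (p : ℕ) [Fact p.Prime] (R : CpTambara.{u} p)
    (hR : ¬ Function.Surjective R.tr) :
    (CpTambara.ghostToCoind R).Etale ∧
      ¬ IsOpenMap (CpTambara.Spec.map (CpTambara.ghostToCoind R)) :=
  ⟨CpTambara.coindUnit_etale (CpTambara.ghost R),
    CpTambara.not_isOpenMap_spec_ghostToCoind R hR⟩
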